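/- Let $p>3$ be a prime. Write $\mathbb Z_p$ for the ring of $p$-adic integers, $f_n=\sum_{k=0}^n\binom nk^3$ $(n\ge 0)$ for the Franel numbers, $\left(\frac p3\right)$ for the Legendre symbol, and $q_p(2)=(2^{p-1}-1)/p$ for the Fermat quotient. For $x\in\mathbb Z_p$ put $\binom{x}{k}=x(x-1)\cdots(x-k+1)/k!\in\mathbb Z_p$, and for $a,b\in\mathbb Q_p$ let $a\equiv b\pmod{p^n}$ mean $a-b\in p^n\mathbb Z_p$. Then for every $r\in\mathbb Z_p$, $$\sum_{k=0}^{p-1}(-1)^k\binom{k+r}k f_k\equiv\sum_{k=0}^{p-1}\binom{2k}k\binom{k+r}k^2\pmod{p^2}.$$ In particular, $$\sum_{k=0}^{p-1}(-1)^kf_k\equiv\left(\frac p3\right)\pmod{p^2},\qquad \sum_{k=0}^{p-1}(-1)^k k f_k\equiv-\frac23\left(\frac p3\right)\pmod{p^2},$$ $$\sum_{k=0}^{p-1}(-1)^k k^2 f_k\equiv\frac{10}{27}\left(\frac p3\right)\pmod{p^2},\qquad \sum_{k=0}^{p-1}\frac{\binom{2k}kf_k}{(-4)^k}\equiv\sum_{k=0}^{p-1}\frac{\binom{2k}k^3}{16^k}\pmod{p^2}.$$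 Moreover, $$\sum_{k=1}^{p-1}\frac{(-1)^k}{k}f_k\equiv0\pmod{p^2},\qquad \sum_{k=1}^{p-1}\frac{(-1)^k}{k^2}f_k\equiv0\pmod p,$$ $$\sum_{k=1}^{p-1}\frac{(-1)^k}{k}f_{k-1}\equiv 3q_p(2)+3p\,q_p(2)^2\pmod{p^2}.$$ -/

import Mathlib

/-- The Franel numbers `f_n = ∑_{k=0}^n C(n,k)^3`. -/
def franel (n : ℕ) : ℕ := ∑ k ∈ Finset.range (n + 1), n.choose k ^ 3

/-- The Fermat quotient `q_p(a) = (a^{p-1} - 1) / p`, as a rational number. -/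
def fermatQuotient (p : ℕ) (a : ℤ) : ℚ := ((a : ℚ) ^ (p - 1) - 1) / (p : ℚ)

/-- Congruence modulo `p ^ n` in the `p`-adic sense: `a - b` lies in `p ^ n ℤ_p`.  For rational
numbers with denominators prime to `p` this is the usual congruence of fractions. -/
def PadicCongr (p : ℕ) [Fact p.Prime] (n : ℕ) (a b : ℚ_[p]) : Prop :=
  ∃ z : ℤ_[p], a - b = (p : ℚ_[p]) ^ n * (z : ℚ_[p])

section

open Finset

/-! Everything rests on f_l = ∑_k C(2k,k) C(l,k) C(k,l-k). Given a weight w, put this into ∑_{l<p}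
w_l f_l and write l = k+j. This gives ∑_{k<p} C(2k,k) S_k with S_k = ∑_j w_{k+j} C(k+j,k) C(k,j),
minus a tail over p ≤ l ≤ 2p-2 (`sum_mul_franel`). Each tail coefficient is divisible by p²
(`sq_dvd_sum_choose`), so where the weights are p-integral the tail drops out and only the closed
form of S_k matters.

For w_l = (-1)^l C(l+r,l), Chu-Vandermonde gives S_k = C(k+r,k)², the general congruence. Taking r =
0, 1, 2 reduces the first three special cases to ∑ C(2k,k) ≡ (p/3) mod p² and a telescoping
identity; r = -1/2 gives the fourth.

For w_l = (-1)^l/l and (-1)^l/l², finite differences give S_k = 0 and C(2k,k) S_k = -1/k² for k > 0.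
The tail then has one non-integral weight, at l = p. Its coefficient f_p - C(2p,p) is divisible by
p³, so a factor p^(3-e) survives division by p^e.

For w_l = (-1)^l/(l+1), C(2k,k) S_k = 1/(2k+1), and these sum to 1/p mod p². Splitting off l = p-1
turns the last congruence into the value of f_{p-1} mod p³, which comes from Morley's congruence. -/

/-- `x ∈ p ^ n ℤ_p`. -/
def PadicDvd (p : ℕ) [Fact p.Prime] (n : ℕ) (x : ℚ_[p]) : Prop :=
  ∃ z : ℤ_[p], x = (p : ℚ_[p]) ^ n * (z : ℚ_[p])

/-! ### Calculus of divisibility by powers of p in `ℚ_[p]` -/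

namespace PadicDvd

variable {p : ℕ} [Fact p.Prime] {m n : ℕ} {x y : ℚ_[p]}

theorem zero : PadicDvd p n 0 := ⟨0, by simp⟩

theorem add (hx : PadicDvd p n x) (hy : PadicDvd p n y) : PadicDvd p n (x + y) := by
  obtain ⟨a, rfl⟩ := hx
  obtain ⟨b, rfl⟩ := hy
  exact ⟨a + b, by push_cast; ring⟩

theorem neg (hx : PadicDvd p n x) : PadicDvd p n (-x) := by
  obtain ⟨a, rfl⟩ := hx
  exact ⟨-a, by push_cast; ring⟩

theorem sub (hx : PadicDvd p n x) (hy : PadicDvd p n y) : PadicDvd p n (x - y) := by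
  rw [sub_eq_add_neg]
  exact hx.add hy.neg

theorem mul (hx : PadicDvd p m x) (hy : PadicDvd p n y) : PadicDvd p (m + n) (x * y) := by
  obtain ⟨a, rfl⟩ := hx
  obtain ⟨b, rfl⟩ := hy
  exact ⟨a * b, by push_cast; ring⟩

theorem mul_left (hx : PadicDvd p 0 x) (hy : PadicDvd p n y) : PadicDvd p n (x * y) := by
  simpa using hx.mul hy

theorem mul_right (hx : PadicDvd p n x) (hy : PadicDvd p 0 y) : PadicDvd p n (x * y) := by
  simpa using hx.mul hy

theorem mono (hmn : m ≤ n) (hx : PadicDvd p n x) : PadicDvd p m x := by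
  obtain ⟨a, rfl⟩ := hx
  refine ⟨p ^ (n - m) * a, ?_⟩
  push_cast
  rw [← mul_assoc, ← pow_add, Nat.add_sub_cancel' hmn]

theorem sum {ι : Type*} {s : Finset ι} {f : ι → ℚ_[p]} (h : ∀ i ∈ s, PadicDvd p n (f i)) :
    PadicDvd p n (∑ i ∈ s, f i) := by
  classical
  induction s using Finset.induction_on with
  | empty => simpa using zero
  | insert a s ha ih =>
    rw [Finset.sum_insert ha]
    exact (h a (mem_insert_self a s)).add (ih fun i hi => h i (mem_insert_of_mem hi))

theorem padicInt (z : ℤ_[p]) : PadicDvd p 0 (z : ℚ_[p]) := ⟨z, by simp⟩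

theorem natCast (k : ℕ) : PadicDvd p 0 (k : ℚ_[p]) := ⟨k, by simp⟩

theorem intCast (k : ℤ) : PadicDvd p 0 (k : ℚ_[p]) := ⟨k, by simp⟩

theorem one : PadicDvd p 0 (1 : ℚ_[p]) := ⟨1, by simp⟩

theorem neg_one_pow (k : ℕ) : PadicDvd p 0 ((-1 : ℚ_[p]) ^ k) := ⟨(-1) ^ k, by simp⟩

theorem pow (k : ℕ) (hx : PadicDvd p 0 x) : PadicDvd p 0 (x ^ k) := by
  obtain ⟨a, rfl⟩ := hx
  exact ⟨a ^ k, by simp⟩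

theorem prime_pow (n : ℕ) : PadicDvd p n ((p : ℚ_[p]) ^ n) := ⟨1, by simp⟩

theorem prime : PadicDvd p 1 (p : ℚ_[p]) := ⟨1, by simp⟩

theorem of_int_dvd {k : ℤ} (h : (p : ℤ) ^ n ∣ k) : PadicDvd p n (k : ℚ_[p]) := by
  obtain ⟨c, rfl⟩ := h
  exact ⟨c, by push_cast; ring⟩

theorem of_nat_dvd {k : ℕ} (h : p ^ n ∣ k) : PadicDvd p n (k : ℚ_[p]) := by
  obtain ⟨c, rfl⟩ := h
  exact ⟨c, by push_cast; ring⟩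

theorem natCast_inv {k : ℕ} (h : ¬ p ∣ k) : PadicDvd p 0 ((k : ℚ_[p])⁻¹) := by
  have hk : ‖(k : ℚ_[p])‖ = 1 := by
    rw [Padic.norm_natCast_eq_one_iff]
    exact (Nat.Prime.coprime_iff_not_dvd Fact.out).2 h
  exact ⟨⟨(k : ℚ_[p])⁻¹, by rw [norm_inv, hk, inv_one]⟩, by simp⟩

theorem natCast_inv_of_lt {k : ℕ} (h0 : 0 < k) (h : k < p) : PadicDvd p 0 ((k : ℚ_[p])⁻¹) :=
  natCast_inv (Nat.not_dvd_of_pos_of_lt h0 h)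

theorem of_pow_mul (h : PadicDvd p (m + n) ((p : ℚ_[p]) ^ m * x)) : PadicDvd p n x := by
  obtain ⟨a, ha⟩ := h
  have hp : (p : ℚ_[p]) ^ m ≠ 0 :=
    pow_ne_zero _ (Nat.cast_ne_zero.2 (Fact.out : p.Prime).ne_zero)
  exact ⟨a, mul_left_cancel₀ hp (by rw [ha, pow_add, mul_assoc])⟩

theorem div_prime_pow (h : PadicDvd p (n + m) x) : PadicDvd p n (x / (p : ℚ_[p]) ^ m) := by
  have hp : (p : ℚ_[p]) ^ m ≠ 0 :=
    pow_ne_zero _ (Nat.cast_ne_zero.2 (Fact.out : p.Prime).ne_zero)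
  refine of_pow_mul (m := m) ?_
  rw [mul_div_cancel₀ _ hp, add_comm]
  exact h

end PadicDvd

/-! ### Expansion of Franel numbers and the p² tail -/

section FranelExpansion

theorem choose_sq_mul_choose_two_mul (l k : ℕ) :
    l.choose k ^ 2 * (2 * k).choose l = (2 * k).choose k * l.choose k * k.choose (l - k) := by
  rcases lt_or_ge l k with h | h
  · simp [Nat.choose_eq_zero_of_lt h]
  rcases lt_or_ge (2 * k) l with h' | h'
  · rw [Nat.choose_eq_zero_of_lt h', Nat.choose_eq_zero_of_lt (show k < l - k by omega)]
    simp
  · have := Nat.choose_mul (n := 2 * k) h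
    rw [show 2 * k - k = k by omega] at this
    rw [pow_two, mul_assoc, mul_comm (l.choose k) ((2 * k).choose l), this]
    ring

/-- Vandermonde is used twice: it splits C(2k,n) into ∑_j C(k,j) C(k,n-j), and, after both factors
C(n,k) are absorbed, it sums C(n-j,n-k) C(j,n-k) over k to C(n,j), the third factor of the cube. -/
theorem franel_eq_sum_choose_sq_mul_choose (n : ℕ) :
    franel n = ∑ k ∈ range (n + 1), n.choose k ^ 2 * (2 * k).choose n := by
  have hterm : ∀ k ∈ range (n + 1), n.choose k ^ 2 * (2 * k).choose n =
      ∑ j ∈ range (n + 1), n.choose j ^ 2 * ((n - j).choose (n - k) * j.choose (n - k)) := by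
    intro k hk
    have hk : k ≤ n := by simpa [Nat.lt_succ_iff] using hk
    rw [two_mul, Nat.add_choose_eq, Nat.sum_antidiagonal_eq_sum_range_succ
      (f := fun i j => k.choose i * k.choose j), mul_sum]
    refine sum_congr rfl fun j hj => ?_
    have hj : j ≤ n := by simpa [Nat.lt_succ_iff] using hj
    have key : ∀ i ≤ n, n.choose k * k.choose i = n.choose i * (n - i).choose (n - k) := by
      intro i hi
      rcases le_or_gt i k with hik | hik
      · rw [Nat.choose_mul hik, show n - k = (n - i) - (k - i) by omega,
          Nat.choose_symm (by omega)]
      · rw [Nat.choose_eq_zero_of_lt hik, Nat.choose_eq_zero_of_lt (show n - i < n - k by omega)]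
        simp
    have h1 := key j hj
    have h2 := key (n - j) (Nat.sub_le _ _)
    rw [Nat.choose_symm hj, Nat.sub_sub_self hj] at h2
    calc n.choose k ^ 2 * (k.choose j * k.choose (n - j))
        = (n.choose k * k.choose j) * (n.choose k * k.choose (n - j)) := by ring
      _ = _ := by rw [h1, h2]; ring
  rw [sum_congr rfl hterm, sum_comm]
  refine sum_congr rfl fun j hj => ?_
  have hj : j ≤ n := by simpa [Nat.lt_succ_iff] using hj
  rw [← mul_sum, pow_succ]
  congr 1
  have hv : n.choose j = ∑ i ∈ range (j + 1), (n - j).choose i * j.choose (j - i) := by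
    conv_lhs => rw [show n = (n - j) + j by omega, Nat.add_choose_eq]
    rw [Nat.sum_antidiagonal_eq_sum_range_succ
      (f := fun a b => (n - j).choose a * j.choose b)]
  rw [hv, ← sum_range_reflect (fun k => (n - j).choose (n - k) * j.choose (n - k))]
  have : ∀ k ∈ range (n + 1), (n - j).choose (n - (n + 1 - 1 - k)) *
      j.choose (n - (n + 1 - 1 - k)) = (n - j).choose k * j.choose k := by
    intro k hk
    have hk : k ≤ n := by simpa [Nat.lt_succ_iff] using hk
    rw [show n - (n + 1 - 1 - k) = k by omega]
  rw [sum_congr rfl this]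
  rw [← sum_subset (range_subset_range.2 (show j + 1 ≤ n + 1 by omega))]
  · refine sum_congr rfl fun i hi => ?_
    rw [Nat.choose_symm (by simpa [Nat.lt_succ_iff] using hi)]
  · intro i _ hi
    rw [Nat.choose_eq_zero_of_lt (show j < i by simpa using hi), mul_zero]

theorem franel_eq_sum (n : ℕ) :
    franel n = ∑ k ∈ range (n + 1), (2 * k).choose k * n.choose k * k.choose (n - k) := by
  rw [franel_eq_sum_choose_sq_mul_choose]
  exact sum_congr rfl fun k _ => choose_sq_mul_choose_two_mul n k

/-- Exchange of summation. For fixed k < N the support is k ≤ l ≤ 2k ≤ 2N-2; the full inner sum over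
this support has a closed form for good w, and the subtracted sum removes its part with l ≥ N. -/
theorem sum_mul_franel {R : Type*} [CommRing R] (w : ℕ → R) (N : ℕ) :
    ∑ l ∈ range N, w l * (franel l : R) = ∑ k ∈ range N, ((2 * k).choose k : R) *
      (∑ j ∈ range (k + 1), w (k + j) * ((k + j).choose k : R) * (k.choose j : R)) -
      ∑ l ∈ Ico N (2 * N - 1), w l *
        ((∑ k ∈ range N, (2 * k).choose k * l.choose k * k.choose (l - k) : ℕ) : R) := by
  have hl : ∀ l ∈ range N, w l * (franel l : R) =
      ∑ k ∈ range N, w l * ((2 * k).choose k * l.choose k * k.choose (l - k) : R) := by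
    intro l hl
    rw [franel_eq_sum, Nat.cast_sum, mul_sum]
    rw [sum_subset (range_subset_range.2 (show l + 1 ≤ N by simpa using hl))]
    · simp
    · intro k _ hk
      rw [Nat.choose_eq_zero_of_lt (show l < k by simpa using hk)]
      simp
  have hk : ∀ k ∈ range N,
      ∑ j ∈ range (k + 1), w (k + j) * ((k + j).choose k : R) * (k.choose j : R) =
      ∑ l ∈ range (2 * N - 1), w l * (l.choose k * k.choose (l - k) : R) := by
    intro k hk
    have hk : k < N := by simpa using hk
    rw [← sum_subset (show Ico k (2 * k + 1) ⊆ range (2 * N - 1) by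
      intro l; simp only [mem_Ico, mem_range]; omega)]
    · rw [sum_Ico_eq_sum_range, show 2 * k + 1 - k = k + 1 by omega]
      refine sum_congr rfl fun j _ => ?_
      rw [Nat.add_sub_cancel_left, mul_assoc]
    · intro l _ hl
      simp only [mem_Ico, not_and, not_lt] at hl
      rcases lt_or_ge l k with h | h
      · simp [Nat.choose_eq_zero_of_lt h]
      · rw [Nat.choose_eq_zero_of_lt (show k < l - k by have := hl h; omega)]
        simp
  rw [sum_congr rfl hl, sum_comm, eq_sub_iff_add_eq]
  have hr : ∀ l ∈ Ico N (2 * N - 1), w l *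
        ((∑ k ∈ range N, (2 * k).choose k * l.choose k * k.choose (l - k) : ℕ) : R) =
      ∑ k ∈ range N, w l * ((2 * k).choose k * l.choose k * k.choose (l - k) : R) := by
    intro l _
    rw [Nat.cast_sum, mul_sum]
    simp
  rw [sum_congr rfl hr, sum_comm (s := Ico _ _), ← sum_add_distrib]
  refine sum_congr rfl fun k hk' => ?_
  have hN : N ≤ 2 * N - 1 := by have : k < N := by simpa using hk'
                                omega
  rw [hk k hk', range_eq_Ico, range_eq_Ico, ← sum_Ico_consecutive _ (Nat.zero_le N) hN, mul_add,
    mul_sum, mul_sum]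
  congr 1 <;> exact sum_congr rfl fun _ _ => by ring

/-- A nonzero term has k < p ≤ l ≤ 2k. Then k + k and k + (l-k) both carry past p, so p divides each
of C(2k,k) and C(l,k). -/
theorem sq_dvd_sum_choose {p : ℕ} (hp : p.Prime) {l : ℕ} (hl : p ≤ l) :
    p ^ 2 ∣ ∑ k ∈ range p, (2 * k).choose k * l.choose k * k.choose (l - k) := by
  refine dvd_sum fun k hk => ?_
  have hk : k < p := by simpa using hk
  rcases lt_or_ge (2 * k) l with h | h
  · rw [Nat.choose_eq_zero_of_lt (show k < l - k by omega)]
    simp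
  · refine Dvd.dvd.mul_right ?_ _
    rw [pow_two]
    refine mul_dvd_mul ?_ ?_
    · rw [two_mul]
      exact hp.dvd_choose_add hk hk (by omega)
    · have := hp.dvd_choose_add hk (show l - k < p by omega) (by omega)
      rwa [Nat.add_sub_cancel' (by omega)] at this

end FranelExpansion

/-! ### Chu-Vandermonde in a binomial ring -/

section BinomialRing

variable {R : Type*} [CommRing R] [BinomialRing R]

/-- The product of the first two binomials is C(k+r,k) C(k+j+r,j), and C(k+j+r,j) = (-1)^j
C(-(k+r+1),j). Convolving with C(k,k-j) gives C(-(r+1),k) = (-1)^k C(k+r,k), the second factor of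
the square. -/
theorem sum_neg_one_pow_mul_ringChoose (r : R) (k : ℕ) :
    ∑ j ∈ range (k + 1), (-1) ^ (k + j) * Ring.choose (((k + j : ℕ) : R) + r) (k + j) *
      ((k + j).choose k : R) * (k.choose j : R) = Ring.choose ((k : R) + r) k ^ 2 := by
  have h1 : ∀ j ∈ range (k + 1), (-1) ^ (k + j) * Ring.choose (((k + j : ℕ) : R) + r) (k + j) *
      ((k + j).choose k : R) * (k.choose j : R) =
      ((-1) ^ k * Ring.choose ((k : R) + r) k) *
        (Ring.choose (-(k + r + 1)) j * Ring.choose (k : R) (k - j)) := by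
    intro j hj
    have hj : j ≤ k := by simpa [Nat.lt_succ_iff] using hj
    have h2 := Ring.choose_smul_choose (((k + j : ℕ) : R) + r) (Nat.le_add_left j k)
    rw [nsmul_eq_mul, Nat.add_sub_cancel, show ((k + j : ℕ) : R) + r - j = k + r by
      push_cast; ring, ← Nat.choose_symm_add] at h2
    have h3 := Ring.choose_neg ((k : R) + r + 1) j
    rw [show (k : R) + r + 1 + j - 1 = ((k + j : ℕ) : R) + r by push_cast; ring] at h3
    rw [Ring.choose_natCast, Nat.choose_symm hj, h3, pow_add]
    have h4 : Int.negOnePow j • Ring.choose (((k + j : ℕ) : R) + r) j =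
        (-1) ^ j * Ring.choose (((k + j : ℕ) : R) + r) j := by
      rw [Units.smul_def, zsmul_eq_mul]
      simp [Int.negOnePow]
    rw [h4]
    linear_combination (-1) ^ k * (-1) ^ j * (k.choose j : R) * h2
  have hv := Ring.add_choose_eq k (Commute.all (-((k : R) + r + 1)) (k : R))
  rw [Nat.sum_antidiagonal_eq_sum_range_succ
    (f := fun a b => Ring.choose (-((k : R) + r + 1)) a * Ring.choose (k : R) b)] at hv
  rw [sum_congr rfl h1, ← mul_sum, ← hv, show -((k : R) + r + 1) + k = -(r + 1) by ring,
    Ring.choose_neg, show r + 1 + k - 1 = k + r by ring, Units.smul_def, zsmul_eq_mul]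
  have : ((-1 : R) ^ k) * (-1) ^ k = 1 := by rw [← mul_pow]; simp
  simp only [Int.negOnePow, zpow_natCast, Units.val_pow_eq_pow_val, Units.val_neg, Units.val_one,
    Int.cast_pow, Int.cast_neg, Int.cast_one]
  linear_combination Ring.choose ((k : R) + r) k ^ 2 * this

theorem succ_mul_ringChoose (r : R) (k : ℕ) :
    ((k : R) + 1) * Ring.choose (((k + 1 : ℕ) : R) + r) (k + 1) =
      ((k : R) + 1 + r) * Ring.choose ((k : R) + r) k := by
  have h := Ring.choose_smul_choose (((k + 1 : ℕ) : R) + r) (Nat.le_add_left 1 k)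
  rw [Nat.choose_one_right, nsmul_eq_mul, Ring.choose_one_right, Nat.add_sub_cancel,
    show ((k + 1 : ℕ) : R) + r - (1 : ℕ) = k + r by push_cast; ring] at h
  push_cast at h ⊢
  exact h

end BinomialRing

/-! ### The congruence with parameter r, and its value at r = -1/2 -/

section FranelCongruences

variable {p : ℕ} [Fact p.Prime]

theorem padicDvd_sum_ringChoose_mul_franel (r : ℤ_[p]) :
    PadicDvd p 2
      (((∑ k ∈ range p,
          (-1) ^ k * Ring.choose ((k : ℤ_[p]) + r) k * (franel k : ℤ_[p]) : ℤ_[p]) : ℚ_[p]) -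
        ((∑ k ∈ range p,
          ((2 * k).choose k : ℤ_[p]) * Ring.choose ((k : ℤ_[p]) + r) k ^ 2 : ℤ_[p]) : ℚ_[p])) := by
  rw [← PadicInt.coe_sub, sum_mul_franel]
  simp only [sum_neg_one_pow_mul_ringChoose]
  rw [sub_sub_cancel_left, PadicInt.coe_neg, PadicInt.coe_sum]
  refine (PadicDvd.sum fun l hl => ?_).neg
  rw [PadicInt.coe_mul, PadicInt.coe_natCast]
  exact (PadicDvd.padicInt _).mul_left
    (PadicDvd.of_nat_dvd (sq_dvd_sum_choose Fact.out (mem_Ico.1 hl).1))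

/-- Both sides start at 1 and satisfy (k+1) u_{k+1} = (k+1/2) u_k. -/
theorem coe_ringChoose_add_neg_half {r : ℤ_[p]} (hr : 2 * (r : ℚ_[p]) = -1) (k : ℕ) :
    ((Ring.choose ((k : ℤ_[p]) + r) k : ℤ_[p]) : ℚ_[p]) = ((2 * k).choose k : ℚ_[p]) / 4 ^ k := by
  induction k with
  | zero => simp
  | succ k ih =>
    have h := congrArg (fun z : ℤ_[p] => (z : ℚ_[p])) (succ_mul_ringChoose r k)
    have h' := congrArg (fun z : ℕ => (z : ℚ_[p])) (Nat.succ_mul_centralBinom_succ k)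
    simp only [Nat.centralBinom] at h'
    push_cast at h h' ⊢
    rw [ih] at h
    have hk : (k : ℚ_[p]) + 1 ≠ 0 := by exact_mod_cast k.succ_ne_zero
    refine mul_left_cancel₀ hk (h.trans ?_)
    have h2 : (r : ℚ_[p]) = -1 / 2 := by
      rw [eq_div_iff (by norm_num)]
      linear_combination hr
    generalize (r : ℚ_[p]) = s at h2
    subst h2
    rw [← mul_div_assoc ((k : ℚ_[p]) + 1), h']
    field_simp
    ring

end FranelCongruences

/-! ### Alternating binomial sums by finite differences -/

section AlternatingSums

open Polynomial fwdDiff in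
theorem Polynomial.sum_neg_one_pow_mul_choose_mul_eval {K : Type*} [CommRing K] {P : K[X]} {n : ℕ}
    (hP : P.natDegree < n) :
    ∑ j ∈ range (n + 1), (-1) ^ j * (n.choose j : K) * P.eval (j : K) = 0 := by
  have h := congrFun (Polynomial.fwdDiff_iter_eq_zero_of_degree_lt hP) 0
  rw [fwdDiff_iter_eq_sum_shift] at h
  have h2 : ∑ j ∈ range (n + 1), (-1) ^ j * (n.choose j : K) * P.eval (j : K) =
      (-1) ^ n * ∑ k ∈ range (n + 1), ((-1 : ℤ) ^ (n - k) * n.choose k) •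
        P.eval (0 + k • (1 : K)) := by
    rw [mul_sum]
    refine sum_congr rfl fun j hj => ?_
    have hj : j ≤ n := by simpa [Nat.lt_succ_iff] using hj
    obtain ⟨d, rfl⟩ := Nat.exists_eq_add_of_le hj
    have : ((-1 : K) ^ d) * (-1) ^ d = 1 := by rw [← mul_pow]; simp
    rw [zsmul_eq_mul, Nat.add_sub_cancel_left, zero_add, nsmul_one, pow_add]
    push_cast
    linear_combination (-(-1 : K) ^ j * ((j + d).choose j : K) * P.eval (j : K)) * this
  rw [h2, h]
  simp

theorem fwdDiff_iter_inv_natCast_add_one (K : Type*) [Field K] [CharZero K] (n y : ℕ) :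
    (fwdDiff 1)^[n] (fun i : ℕ => ((i : K) + 1)⁻¹) y =
      (-1) ^ n * (n.factorial * y.factorial : K) / (y + n + 1).factorial := by
  induction n generalizing y with
  | zero =>
    have h1 : (y : K) + 1 ≠ 0 := by exact_mod_cast y.succ_ne_zero
    have h2 : (y.factorial : K) ≠ 0 := by exact_mod_cast y.factorial_ne_zero
    simp only [Function.iterate_zero, id_eq, Nat.factorial_succ, add_zero]
    push_cast
    field_simp
    simp
  | succ n ih =>
    rw [Function.iterate_succ_apply', fwdDiff, ih, ih]
    have h2 : ((y + n + 1).factorial : K) ≠ 0 := by exact_mod_cast Nat.factorial_ne_zero _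
    have h1 : (y : K) + n + 2 ≠ 0 := by exact_mod_cast (y + n + 1).succ_ne_zero
    rw [show y + 1 + n + 1 = (y + n + 1) + 1 by ring, show y + (n + 1) + 1 = (y + n + 1) + 1 by ring,
      Nat.factorial_succ (y + n + 1), Nat.factorial_succ y, Nat.factorial_succ n]
    push_cast
    rw [show (y : K) + n + 1 + 1 = y + n + 2 by ring]
    field_simp
    ring

theorem sum_neg_one_pow_mul_choose_div (K : Type*) [Field K] [CharZero K] (n m : ℕ) :
    ∑ j ∈ range (n + 1), (-1) ^ j * (n.choose j : K) / ((m : K) + j + 1) =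
      (n.factorial * m.factorial : K) / (m + n + 1).factorial := by
  have h := fwdDiff_iter_inv_natCast_add_one K n m
  rw [fwdDiff_iter_eq_sum_shift] at h
  have hn : ((-1 : K) ^ n) * (-1) ^ n = 1 := by rw [← mul_pow]; simp
  have h2 : ∑ j ∈ range (n + 1), (-1) ^ j * (n.choose j : K) / ((m : K) + j + 1) =
      (-1) ^ n * ∑ k ∈ range (n + 1), ((-1 : ℤ) ^ (n - k) * n.choose k) •
        (((m + k • 1 : ℕ) : K) + 1)⁻¹ := by
    rw [mul_sum]
    refine sum_congr rfl fun j hj => ?_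
    have hj : j ≤ n := by simpa [Nat.lt_succ_iff] using hj
    obtain ⟨d, rfl⟩ := Nat.exists_eq_add_of_le hj
    have : ((-1 : K) ^ d) * (-1) ^ d = 1 := by rw [← mul_pow]; simp
    rw [zsmul_eq_mul, Nat.add_sub_cancel_left, smul_eq_mul, mul_one, pow_add]
    push_cast
    rw [div_eq_mul_inv]
    linear_combination (-(-1 : K) ^ j * ((j + d).choose j : K) * ((m : K) + j + 1)⁻¹) * this
  rw [h2, h, ← mul_div_assoc, ← mul_assoc, hn, one_mul]

open Polynomial in
theorem natDegree_ascPochhammer_comp_X_add_one (K : Type*) [Field K] (m : ℕ) :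
    ((ascPochhammer K m).comp (X + 1)).natDegree = m := by
  rw [natDegree_comp, ascPochhammer_natDegree, show (X + 1 : K[X]) = X + C 1 by simp,
    natDegree_X_add_C, mul_one]

open Polynomial in
theorem eval_ascPochhammer_comp_X_add_one (K : Type*) [Field K] (m j : ℕ) :
    ((ascPochhammer K m).comp (X + 1)).eval (j : K) = m.factorial * ((m + j).choose m : K) := by
  rw [eval_comp, eval_add, eval_X, eval_one, ← Nat.cast_add_one, ← ascPochhammer_eval_cast,
    ascPochhammer_nat_eq_ascFactorial, Nat.ascFactorial_eq_factorial_mul_choose, add_comm j m]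
  push_cast
  rfl

theorem sum_neg_one_pow_mul_choose_mul_choose {K : Type*} [Field K] [CharZero K] {n m : ℕ}
    (h : m < n) :
    ∑ j ∈ range (n + 1), (-1) ^ j * (n.choose j : K) * ((m + j).choose m : K) = 0 := by
  have h1 := Polynomial.sum_neg_one_pow_mul_choose_mul_eval (K := K) (n := n)
    (P := (ascPochhammer K m).comp (Polynomial.X + 1))
    (by rwa [natDegree_ascPochhammer_comp_X_add_one])
  simp only [eval_ascPochhammer_comp_X_add_one] at h1
  have hm : (m.factorial : K) ≠ 0 := by exact_mod_cast m.factorial_ne_zero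
  refine (mul_eq_zero.1 ((mul_sum _ _ _).trans (Eq.trans ?_ h1))).resolve_left hm
  exact sum_congr rfl fun j _ => by ring

open Polynomial in
-- Divide P(j) = m! C(m+j,m) = (j+1)⋯(j+m) by j+m+1. The quotient has degree below n, or is zero, so
-- the n-th difference kills it; the remainder P(-(m+1)) = (-1)^m m! multiplies the known sum for
-- 1/(m+j+1).
theorem sum_neg_one_pow_mul_choose_mul_choose_div {K : Type*} [Field K] [CharZero K] {n m : ℕ}
    (h : m ≤ n) :
    ∑ j ∈ range (n + 1), (-1) ^ j * (n.choose j : K) * ((m + j).choose m : K) / ((m : K) + j + 1) =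
      (-1) ^ m * (n.factorial * m.factorial : K) / (m + n + 1).factorial := by
  have hm : (m.factorial : K) ≠ 0 := by exact_mod_cast m.factorial_ne_zero
  have heval : ((ascPochhammer K m).comp (X + 1)).eval (-(m + 1) : K) = (-1) ^ m * m.factorial := by
    rw [eval_comp, eval_add, eval_X, eval_one, show -((m : K) + 1) + 1 = -m by ring,
      ascPochhammer_eval_neg_eq_descPochhammer, descPochhammer_eval_eq_descFactorial,
      Nat.descFactorial_self]
  obtain ⟨Q, hQ, hdeg⟩ : ∃ Q : K[X], (ascPochhammer K m).comp (X + 1) =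
      C ((-1) ^ m * (m.factorial : K)) + (X + C ((m : K) + 1)) * Q ∧ (Q.natDegree < n ∨ Q = 0) := by
    obtain ⟨Q, hQ⟩ : (X - C (-((m : K) + 1))) ∣ (ascPochhammer K m).comp (X + 1) -
        C ((-1) ^ m * (m.factorial : K)) := by
      rw [dvd_iff_isRoot, IsRoot, eval_sub, eval_C, heval, sub_self]
    refine ⟨Q, ?_, ?_⟩
    · rw [show X + C ((m : K) + 1) = X - C (-((m : K) + 1)) by rw [C_neg, sub_neg_eq_add], ← hQ]
      ring
    · by_cases hQ0 : Q = 0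
      · exact Or.inr hQ0
      · left
        have h1 := congrArg natDegree hQ
        rw [natDegree_sub_C, natDegree_ascPochhammer_comp_X_add_one,
          natDegree_mul (X_sub_C_ne_zero _) hQ0, natDegree_X_sub_C] at h1
        omega
  have hQsum : ∑ j ∈ range (n + 1), (-1) ^ j * (n.choose j : K) * Q.eval (j : K) = 0 := by
    rcases hdeg with hdeg | rfl
    · exact sum_neg_one_pow_mul_choose_mul_eval hdeg
    · simp
  refine mul_left_cancel₀ hm ?_
  rw [mul_sum]
  have hterm : ∀ j ∈ range (n + 1), (m.factorial : K) *
      ((-1) ^ j * (n.choose j : K) * ((m + j).choose m : K) / ((m : K) + j + 1)) =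
      (-1) ^ m * (m.factorial : K) * ((-1) ^ j * (n.choose j : K) / ((m : K) + j + 1)) +
        (-1) ^ j * (n.choose j : K) * Q.eval (j : K) := by
    intro j _
    have h1 : (m : K) + j + 1 ≠ 0 := by exact_mod_cast (m + j).succ_ne_zero
    have h2 := congrArg (eval (j : K)) hQ
    rw [eval_ascPochhammer_comp_X_add_one] at h2
    simp only [eval_add, eval_C, eval_mul, eval_X] at h2
    field_simp
    linear_combination (n.choose j : K) * h2
  rw [sum_congr rfl hterm, sum_add_distrib, hQsum, add_zero, ← mul_sum,
    sum_neg_one_pow_mul_choose_div]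
  ring

/-- C(k+j,k)/(k+j) = C(k+j-1,k-1)/k is a polynomial in j of degree k-1, annihilated by the k-th
difference. -/
theorem sum_neg_one_pow_div_mul_choose {K : Type*} [Field K] [CharZero K] {k : ℕ} (hk : 0 < k) :
    ∑ j ∈ range (k + 1), (-1) ^ (k + j) / ((k + j : ℕ) : K) * ((k + j).choose k : K) *
      (k.choose j : K) = 0 := by
  obtain ⟨m, rfl⟩ := Nat.exists_eq_add_of_le' hk
  have h := sum_neg_one_pow_mul_choose_mul_choose (K := K) m.lt_succ_self
  refine Eq.trans ?_ (mul_eq_zero_of_right ((-1) ^ (m + 1) / ((m : K) + 1)) h)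
  rw [mul_sum]
  refine sum_congr rfl fun j _ => ?_
  have h1 := congrArg (Nat.cast : ℕ → K) (Nat.add_one_mul_choose_eq (m + j) m)
  have h2 : (m : K) + 1 ≠ 0 := by exact_mod_cast m.succ_ne_zero
  have h3 : (m : K) + j + 1 ≠ 0 := by exact_mod_cast (m + j).succ_ne_zero
  rw [show m + 1 + j = m + j + 1 by ring]
  push_cast at h1 ⊢
  field_simp
  rw [show m + j + 1 = j + (m + 1) by ring] at *
  rw [pow_add]
  linear_combination (-(-1) ^ j * (-1) ^ (m + 1) * ((m + 1).choose j : K)) * h1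

theorem choose_two_mul_mul_factorial_mul_factorial (K : Type*) [Field K] [CharZero K] (k : ℕ) :
    ((2 * k).choose k : K) * ((k.factorial : K) * k.factorial) = (2 * k).factorial := by
  have := Nat.choose_mul_factorial_mul_factorial (show k ≤ 2 * k by omega)
  rw [show 2 * k - k = k by omega, mul_assoc] at this
  exact_mod_cast this

/-- The same absorption leaves one denominator k+j. The resulting factorial quotient is cancelled by
C(2k,k). -/
theorem choose_mul_sum_neg_one_pow_div_sq_mul_choose {K : Type*} [Field K] [CharZero K] {k : ℕ}
    (hk : 0 < k) :
    ((2 * k).choose k : K) * ∑ j ∈ range (k + 1), (-1) ^ (k + j) / ((k + j : ℕ) : K) ^ 2 *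
      ((k + j).choose k : K) * (k.choose j : K) = -((k : K) ^ 2)⁻¹ := by
  obtain ⟨m, rfl⟩ := Nat.exists_eq_add_of_le' hk
  have h := sum_neg_one_pow_mul_choose_mul_choose_div (K := K) m.le_succ
  have h2 : (m : K) + 1 ≠ 0 := by exact_mod_cast m.succ_ne_zero
  have hterm : ∀ j ∈ range (m + 1 + 1), (-1) ^ (m + 1 + j) / ((m + 1 + j : ℕ) : K) ^ 2 *
      ((m + 1 + j).choose (m + 1) : K) * ((m + 1).choose j : K) = (-1) ^ (m + 1) / ((m : K) + 1) *
      ((-1) ^ j * ((m + 1).choose j : K) * ((m + j).choose m : K) / ((m : K) + j + 1)) := by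
    intro j _
    have h1 := congrArg (Nat.cast : ℕ → K) (Nat.add_one_mul_choose_eq (m + j) m)
    have h3 : (m : K) + j + 1 ≠ 0 := by exact_mod_cast (m + j).succ_ne_zero
    rw [show m + 1 + j = m + j + 1 by ring]
    push_cast at h1 ⊢
    field_simp
    rw [show m + j + 1 = j + (m + 1) by ring] at *
    rw [pow_add]
    linear_combination (-(-1) ^ j * (-1) ^ (m + 1) * ((m + 1).choose j : K)) * h1
  rw [sum_congr rfl hterm, ← mul_sum, h]
  have hf := choose_two_mul_mul_factorial_mul_factorial K (m + 1)
  rw [show m + (m + 1) + 1 = 2 * (m + 1) by ring, ← hf, Nat.factorial_succ m]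
  have h4 : (m.factorial : K) ≠ 0 := by exact_mod_cast m.factorial_ne_zero
  have h5 : ((2 * (m + 1)).choose (m + 1) : K) ≠ 0 := by
    exact_mod_cast (Nat.choose_pos (by omega)).ne'
  have h6 : ((-1 : K) ^ m) * (-1) ^ m = 1 := by rw [← mul_pow]; simp
  push_cast
  field_simp
  rw [pow_succ]
  linear_combination -h6

theorem choose_mul_sum_neg_one_pow_div_succ_mul_choose (K : Type*) [Field K] [CharZero K] (k : ℕ) :
    ((2 * k).choose k : K) * ∑ j ∈ range (k + 1), (-1) ^ (k + j) / (((k + j : ℕ) : K) + 1) *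
      ((k + j).choose k : K) * (k.choose j : K) = (2 * (k : K) + 1)⁻¹ := by
  have h := sum_neg_one_pow_mul_choose_mul_choose_div (K := K) (le_refl k)
  have hterm : ∀ j ∈ range (k + 1), (-1) ^ (k + j) / (((k + j : ℕ) : K) + 1) *
      ((k + j).choose k : K) * (k.choose j : K) = (-1) ^ k *
      ((-1) ^ j * (k.choose j : K) * ((k + j).choose k : K) / ((k : K) + j + 1)) := by
    intro j _
    push_cast
    ring
  rw [sum_congr rfl hterm, ← mul_sum, h, ← two_mul, Nat.factorial_succ]
  have hf := choose_two_mul_mul_factorial_mul_factorial K k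
  have h4 : (k.factorial : K) ≠ 0 := by exact_mod_cast k.factorial_ne_zero
  have h5 : ((2 * k).choose k : K) ≠ 0 := by
    exact_mod_cast (Nat.choose_pos (by omega)).ne'
  have h6 : ((-1 : K) ^ k) * (-1) ^ k = 1 := by rw [← mul_pow]; simp
  have h7 : 2 * (k : K) + 1 ≠ 0 := by exact_mod_cast (2 * k).succ_ne_zero
  push_cast
  rw [← hf]
  field_simp
  linear_combination h6

open Polynomial in
-- Compare coefficients of X^(2n) in (X-1)^(2n) (X+1)^(2n) = (X²-1)^(2n).
theorem sum_neg_one_pow_mul_choose_sq (n : ℕ) :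
    ∑ k ∈ range (2 * n + 1), (-1 : ℤ) ^ k * ((2 * n).choose k : ℤ) ^ 2 =
      (-1) ^ n * ((2 * n).choose n : ℤ) := by
  have h1 : (X + C (-1 : ℤ)) ^ (2 * n) * (X + C (1 : ℤ)) ^ (2 * n) =
      expand ℤ 2 ((X + C (-1 : ℤ)) ^ (2 * n)) := by
    have h : (X + C (-1 : ℤ)) * (X + C (1 : ℤ)) = expand ℤ 2 (X + C (-1 : ℤ)) := by
      simp
      ring
    rw [← mul_pow, h, ← map_pow]
  have h2 := congrArg (fun P => coeff P (n * 2)) h1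
  simp only [coeff_expand_mul two_pos, coeff_X_add_C_pow, coeff_mul] at h2
  rw [show n * 2 = 2 * n by ring, Nat.sum_antidiagonal_eq_sum_range_succ (f := fun a b =>
    (-1 : ℤ) ^ (2 * n - a) * ((2 * n).choose a : ℤ) * (1 ^ (2 * n - b) * ((2 * n).choose b : ℤ))),
    show 2 * n - n = n by omega] at h2
  rw [← h2]
  refine sum_congr rfl fun k hk => ?_
  have hk : k ≤ 2 * n := by simpa [Nat.lt_succ_iff] using hk
  have hs : (-1 : ℤ) ^ (2 * n - k) = (-1) ^ k := by
    rcases Nat.even_or_odd' k with ⟨d, rfl | rfl⟩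
    · rw [show 2 * n - 2 * d = 2 * (n - d) by omega, pow_mul, pow_mul]
      simp
    · rw [show 2 * n - (2 * d + 1) = 2 * (n - d - 1) + 1 by omega, pow_succ, pow_succ, pow_mul,
        pow_mul]
      simp
  rw [Nat.choose_symm hk, hs]
  ring

end AlternatingSums

/-! ### Sums of central binomial coefficients and the symbol modulo 3 -/

section CentralBinomialSums

/-- The Legendre symbol of `n` modulo `3`. -/
def legendreThree (n : ℕ) : ℤ := if n % 3 = 1 then 1 else if n % 3 = 2 then -1 else 0

theorem legendreThree_add_add (n : ℕ) :
    legendreThree n + legendreThree (n + 1) + legendreThree (n + 2) = 0 := by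
  have : n % 3 < 3 := Nat.mod_lt _ (by norm_num)
  unfold legendreThree
  rw [Nat.add_mod n 1, Nat.add_mod n 2]
  interval_cases n % 3 <;> simp

theorem legendreThree_two_mul (n : ℕ) : legendreThree (2 * n) = -legendreThree n := by
  have : n % 3 < 3 := Nat.mod_lt _ (by norm_num)
  unfold legendreThree
  rw [Nat.mul_mod]
  interval_cases n % 3 <;> simp

theorem legendreSym_three_natCast (n : ℕ) : legendreSym 3 (n : ℤ) = legendreThree n := by
  have h : n % 3 < 3 := Nat.mod_lt _ (by norm_num)
  rw [legendreSym.mod]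
  have : (n : ℤ) % ((3 : ℕ) : ℤ) = ((n % 3 : ℕ) : ℤ) := by push_cast; rfl
  rw [this]
  unfold legendreThree
  interval_cases n % 3
  · simp [legendreSym]
  · simp [legendreSym]
  · simp only [legendreSym]
    decide

/-- An elementary form of (1+ω)^n = (-ω²)^n for a primitive cube root of unity ω. -/
theorem sum_choose_mul_legendreThree (n a : ℕ) :
    ∑ k ∈ range (n + 1), (n.choose k : ℤ) * legendreThree (k + a) =
      (-1) ^ n * legendreThree (a + 2 * n) := by
  induction n generalizing a with
  | zero => simp
  | succ n ih =>
    have h1 := sum_choose_succ_mul (fun i _ => legendreThree (i + a)) n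
    have h : ∑ k ∈ range (n + 1), (n.choose k : ℤ) * legendreThree (k + 1 + a) =
        (-1) ^ n * legendreThree (a + 1 + 2 * n) := by
      rw [← ih (a + 1)]
      exact sum_congr rfl fun k _ => by rw [show k + 1 + a = k + (a + 1) by ring]
    have h2 := legendreThree_add_add (a + 2 * n)
    rw [h1, ih, h, show a + 1 + 2 * n = a + 2 * n + 1 by ring,
      show a + 2 * (n + 1) = a + 2 * n + 2 by ring,
      pow_succ]
    linear_combination (-1) ^ n * h2

theorem sum_legendreThree_mul_choose {p : ℕ} (hp : Odd p) :
    ∑ i ∈ Ico 1 p, legendreThree i * (p.choose i : ℤ) = 0 := by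
  have h := sum_choose_mul_legendreThree p 0
  rw [hp.neg_one_pow, zero_add, legendreThree_two_mul, range_eq_Ico, sum_Ico_succ_top (by omega),
    sum_eq_sum_Ico_succ_bot hp.pos] at h
  simp only [add_zero, zero_add] at h
  rw [Nat.choose_self, show legendreThree 0 = 0 by rfl] at h
  rw [sum_congr rfl fun i _ => mul_comm (legendreThree i) _]
  push_cast at h
  linear_combination h

/-- Apply Pascal's rule twice to row 2n+2. Since the symbol sums to zero over three consecutive
integers, passing from n to n+1 changes the right side only by the boundary term C(2n,n). -/
theorem sum_range_choose_two_mul (n : ℕ) :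
    ∑ k ∈ range n, ((2 * k).choose k : ℤ) =
      ∑ i ∈ range n, legendreThree (i + 1) * ((2 * n).choose (n + i + 1) : ℤ) := by
  induction n with
  | zero => simp
  | succ n ih =>
    rw [sum_range_succ, ih]
    have hpascal : ∀ i, ((2 * (n + 1)).choose (n + 1 + i + 1) : ℤ) = ((2 * n).choose (n + i) : ℤ) +
        2 * ((2 * n).choose (n + i + 1) : ℤ) + ((2 * n).choose (n + i + 2) : ℤ) := by
      intro i
      rw [show 2 * (n + 1) = 2 * n + 1 + 1 by ring, show n + 1 + i + 1 = n + i + 1 + 1 by ring,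
        Nat.choose_succ_succ, Nat.choose_succ_succ, Nat.choose_succ_succ (2 * n) (n + i + 1)]
      push_cast
      ring
    have e1 : ∑ i ∈ range (n + 1), legendreThree (i + 1) * ((2 * n).choose (n + i) : ℤ) =
        ((2 * n).choose n : ℤ) +
          ∑ i ∈ range n, legendreThree (i + 2) * ((2 * n).choose (n + i + 1) : ℤ) := by
      rw [sum_range_succ', add_comm]
      simp [legendreThree, add_assoc]
    have e2 : ∑ i ∈ range (n + 1), legendreThree (i + 1) * ((2 * n).choose (n + i + 1) : ℤ) =
        ∑ i ∈ range n, legendreThree (i + 1) * ((2 * n).choose (n + i + 1) : ℤ) := by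
      rw [sum_range_succ, Nat.choose_eq_zero_of_lt (show 2 * n < n + n + 1 by omega)]
      simp
    have e3 : ∑ i ∈ range (n + 1), legendreThree (i + 1) * ((2 * n).choose (n + i + 2) : ℤ) =
        ∑ i ∈ range n, legendreThree i * ((2 * n).choose (n + i + 1) : ℤ) := by
      have := sum_range_succ' (fun i => legendreThree i * ((2 * n).choose (n + i + 1) : ℤ)) (n + 1)
      rw [sum_range_succ, sum_range_succ,
        Nat.choose_eq_zero_of_lt (show 2 * n < n + n + 1 by omega),
        Nat.choose_eq_zero_of_lt (show 2 * n < n + (n + 1) + 1 by omega)] at this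
      simp only [show legendreThree 0 = 0 by rfl, Nat.cast_zero, mul_zero, zero_mul, add_zero] at this
      rw [this]
      rfl
    have e4 : ∑ i ∈ range n, legendreThree (i + 2) * ((2 * n).choose (n + i + 1) : ℤ) +
        ∑ i ∈ range n, legendreThree (i + 1) * ((2 * n).choose (n + i + 1) : ℤ) +
        ∑ i ∈ range n, legendreThree i * ((2 * n).choose (n + i + 1) : ℤ) = 0 := by
      rw [← sum_add_distrib, ← sum_add_distrib]
      refine sum_eq_zero fun i _ => ?_
      linear_combination ((2 * n).choose (n + i + 1) : ℤ) * legendreThree_add_add i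
    simp only [hpascal, mul_add (legendreThree _)]
    rw [sum_add_distrib, sum_add_distrib, e1, e3]
    have e5 : ∑ i ∈ range (n + 1), legendreThree (i + 1) * (2 * ((2 * n).choose (n + i + 1) : ℤ)) =
        2 * ∑ i ∈ range n, legendreThree (i + 1) * ((2 * n).choose (n + i + 1) : ℤ) := by
      rw [← e2, mul_sum]
      exact sum_congr rfl fun i _ => by ring
    rw [e5]
    linear_combination -e4

/-- In C(2p,m) = ∑ C(p,i) C(p,m-i) the two end terms give 2 C(p,m); in every other term both factors
are divisible by p. -/
theorem prime_sq_dvd_choose_two_mul_sub {p : ℕ} (hp : p.Prime) {m : ℕ} (h0 : 0 < m) (hm : m < p) :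
    (p : ℤ) ^ 2 ∣ ((2 * p).choose m : ℤ) - 2 * (p.choose m : ℤ) := by
  rw [two_mul p, Nat.add_choose_eq, Nat.sum_antidiagonal_eq_sum_range_succ
    (f := fun a b => p.choose a * p.choose b), range_eq_Ico, sum_Ico_succ_top (by omega),
    sum_eq_sum_Ico_succ_bot h0]
  simp only [Nat.sub_self, Nat.sub_zero, Nat.choose_zero_right]
  push_cast
  rw [show ∀ a b : ℤ, 1 * a + b + a * 1 - 2 * a = b by intros; ring]
  refine dvd_sum fun i hi => ?_
  simp only [mem_Ico] at hi
  rw [pow_two]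
  exact mul_dvd_mul (Int.natCast_dvd_natCast.2 (hp.dvd_choose_self (by omega) (by omega)))
    (Int.natCast_dvd_natCast.2 (hp.dvd_choose_self (by omega) (by omega)))

theorem prime_sq_dvd_sum_choose_two_mul_sub {p : ℕ} (hp : p.Prime) (h2 : p ≠ 2) :
    (p : ℤ) ^ 2 ∣ ∑ k ∈ range p, ((2 * k).choose k : ℤ) - legendreThree p := by
  have h := sum_legendreThree_mul_choose (hp.odd_of_ne_two h2)
  have hshift := sum_Ico_eq_sum_range
    (fun i => legendreThree i * ((2 * p).choose (p + i) : ℤ)) 1 (p + 1)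
  rw [Nat.add_sub_cancel] at hshift
  rw [sum_range_choose_two_mul, sum_congr rfl fun i _ => by
    rw [add_assoc p i 1, add_comm i 1], ← hshift, sum_Ico_succ_top hp.one_le, ← two_mul,
    Nat.choose_self, Nat.cast_one, mul_one, add_sub_cancel_right,
    ← sub_zero (∑ i ∈ Ico 1 p, _), ← mul_zero 2, ← h, mul_sum, ← sum_sub_distrib]
  refine dvd_sum fun i hi => ?_
  simp only [mem_Ico] at hi
  have h3 : (2 * p).choose (p + i) = (2 * p).choose (p - i) := by
    rw [← Nat.choose_symm (by omega), show 2 * p - (p + i) = p - i by omega]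
  rw [h3, ← Nat.choose_symm hi.2.le, show ∀ a b c : ℤ, a * b - 2 * (a * c) = a * (b - 2 * c) by
    intros; ring]
  exact (prime_sq_dvd_choose_two_mul_sub hp (by omega) (by omega)).mul_left _

/-- The recurrence (k+1) C(2k+2,k+1) = 2(2k+1) C(2k,k) makes the sum telescope. With q(x) = x g(x)
the result is n² g(n) C(2n,n), hence 0 mod p² at n = p when g(p) is p-integral. -/
theorem sum_choose_two_mul_telescope {K : Type*} [CommRing K] (q : K → K) (n : ℕ) :
    ∑ k ∈ range n, ((2 * k).choose k : K) * (2 * (2 * k + 1) * q (k + 1) - k * q k) =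
      n * q n * ((2 * n).choose n : K) := by
  induction n with
  | zero => simp
  | succ n ih =>
    have h := congrArg (Nat.cast : ℕ → K) (Nat.succ_mul_centralBinom_succ n)
    simp only [Nat.centralBinom] at h
    rw [sum_range_succ, ih]
    push_cast at h ⊢
    linear_combination (-q (n + 1)) * h

end CentralBinomialSums

/-! ### The cases r = 0, 1, 2 and r = -1/2 -/

section FranelCongruences

variable {p : ℕ} [Fact p.Prime]

theorem padicDvd_sum_choose_two_mul_sub (h2 : p ≠ 2) :
    PadicDvd p 2 (∑ k ∈ range p, ((2 * k).choose k : ℚ_[p]) - (legendreThree p : ℚ_[p])) := by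
  have := PadicDvd.of_int_dvd (prime_sq_dvd_sum_choose_two_mul_sub (Fact.out : p.Prime) h2)
  push_cast at this
  exact this

theorem padicDvd_sum_neg_one_pow_mul_choose_mul_franel (r : ℕ) :
    PadicDvd p 2 (∑ k ∈ range p, (-1) ^ k * ((k + r).choose k : ℚ_[p]) * (franel k : ℚ_[p]) -
      ∑ k ∈ range p, ((2 * k).choose k : ℚ_[p]) * ((k + r).choose k : ℚ_[p]) ^ 2) := by
  have h := padicDvd_sum_ringChoose_mul_franel (p := p) r
  have hc : ∀ k : ℕ, Ring.choose ((k : ℤ_[p]) + (r : ℤ_[p])) k = ((k + r).choose k : ℤ_[p]) := by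
    intro k
    rw [← Nat.cast_add, Ring.choose_natCast]
  simp only [hc] at h
  rw [PadicInt.coe_sum, PadicInt.coe_sum] at h
  simpa using h

theorem padicDvd_sum_neg_one_pow_mul_franel (h2 : p ≠ 2) :
    PadicDvd p 2 (∑ k ∈ range p, (-1) ^ k * (franel k : ℚ_[p]) - (legendreThree p : ℚ_[p])) := by
  have h := padicDvd_sum_neg_one_pow_mul_choose_mul_franel (p := p) 0
  simp only [add_zero, Nat.choose_self, Nat.cast_one, mul_one, one_pow] at h
  convert h.add (padicDvd_sum_choose_two_mul_sub h2) using 1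
  ring

theorem padicDvd_sum_neg_one_pow_mul_self_mul_franel (hp : 3 < p) :
    PadicDvd p 2 (∑ k ∈ range p, (-1) ^ k * (k : ℚ_[p]) * (franel k : ℚ_[p]) -
      -(2 / 3) * (legendreThree p : ℚ_[p])) := by
  have h0 := padicDvd_sum_neg_one_pow_mul_franel (p := p) (by omega)
  have h1 := padicDvd_sum_neg_one_pow_mul_choose_mul_franel (p := p) 1
  have hb := padicDvd_sum_choose_two_mul_sub (p := p) (by omega)
  have h3 : PadicDvd p 0 (1 / 3 : ℚ_[p]) := by
    rw [one_div]
    exact_mod_cast PadicDvd.natCast_inv_of_lt (p := p) (k := 3) (by omega) hp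
  -- With g = 1/3 the summand is (k+1)² - 1/3.
  have ht := sum_choose_two_mul_telescope (fun x : ℚ_[p] => x * (1 / 3)) p
  have hsq : PadicDvd p 2 (∑ k ∈ range p, ((2 * k).choose k : ℚ_[p]) *
      ((k + 1).choose k : ℚ_[p]) ^ 2 - 1 / 3 * ∑ k ∈ range p, ((2 * k).choose k : ℚ_[p])) := by
    convert (PadicDvd.prime_pow (p := p) 2).mul_right (h3.mul_right
      (PadicDvd.natCast ((2 * p).choose p))) using 1
    rw [show (p : ℚ_[p]) ^ 2 * (1 / 3 * ((2 * p).choose p : ℚ_[p])) =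
      p * (p * (1 / 3)) * ((2 * p).choose p : ℚ_[p]) by ring, ← ht, mul_sum, ← sum_sub_distrib]
    refine sum_congr rfl fun k _ => ?_
    rw [Nat.choose_succ_self_right]
    push_cast
    ring
  have hs : ∑ k ∈ range p, (-1) ^ k * ((k + 1).choose k : ℚ_[p]) * (franel k : ℚ_[p]) =
      ∑ k ∈ range p, (-1) ^ k * (k : ℚ_[p]) * (franel k : ℚ_[p]) +
        ∑ k ∈ range p, (-1) ^ k * (franel k : ℚ_[p]) := by
    rw [← sum_add_distrib]
    refine sum_congr rfl fun k _ => ?_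
    rw [Nat.choose_succ_self_right]
    push_cast
    ring
  rw [hs] at h1
  convert ((h1.add hsq).sub h0).add (h3.mul_left hb) using 1
  ring

theorem natCast_choose_add_two (K : Type*) [Field K] [CharZero K] (k : ℕ) :
    ((k + 2).choose k : K) = ((k : K) + 1) * (k + 2) / 2 := by
  rw [Nat.choose_symm_add, Nat.cast_choose_two]
  push_cast
  ring

theorem padicDvd_sum_neg_one_pow_mul_sq_mul_franel (hp : 3 < p) :
    PadicDvd p 2 (∑ k ∈ range p, (-1) ^ k * (k : ℚ_[p]) ^ 2 * (franel k : ℚ_[p]) -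
      10 / 27 * (legendreThree p : ℚ_[p])) := by
  have h0 := padicDvd_sum_neg_one_pow_mul_franel (p := p) (by omega)
  have h1 := padicDvd_sum_neg_one_pow_mul_self_mul_franel hp
  have h2 := padicDvd_sum_neg_one_pow_mul_choose_mul_franel (p := p) 2
  have hb := padicDvd_sum_choose_two_mul_sub (p := p) (by omega)
  have hinv : PadicDvd p 0 ((108 : ℚ_[p])⁻¹) := by
    have h108 : ¬ p ∣ 108 := by
      intro h
      have h' : p ∣ 2 ^ 2 * 3 ^ 3 := by simpa using h
      rcases (Fact.out : p.Prime).dvd_mul.1 h' with h' | h'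
      · exact absurd (Nat.le_of_dvd two_pos ((Fact.out : p.Prime).dvd_of_dvd_pow h')) (by omega)
      · exact absurd (Nat.le_of_dvd three_pos ((Fact.out : p.Prime).dvd_of_dvd_pow h')) (by omega)
    exact_mod_cast PadicDvd.natCast_inv h108
  -- The quadratic g solves 2(2k+1)(k+1) g(k+1) - k² g(k) = C(k+2,2)² - 5/27.
  have ht := sum_choose_two_mul_telescope
    (fun x : ℚ_[p] => x * ((23 + 12 * x + 9 * x ^ 2) * 108⁻¹)) p
  have hsq : PadicDvd p 2 (∑ k ∈ range p, ((2 * k).choose k : ℚ_[p]) *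
      ((k + 2).choose k : ℚ_[p]) ^ 2 - 5 / 27 * ∑ k ∈ range p, ((2 * k).choose k : ℚ_[p])) := by
    convert (PadicDvd.prime_pow (p := p) 2).mul_right (((PadicDvd.natCast
      (23 + 12 * p + 9 * p ^ 2)).mul_right hinv).mul_right
      (PadicDvd.natCast ((2 * p).choose p))) using 1
    push_cast
    rw [show (p : ℚ_[p]) ^ 2 * ((23 + 12 * (p : ℚ_[p]) + 9 * (p : ℚ_[p]) ^ 2) * 108⁻¹ *
      ((2 * p).choose p : ℚ_[p])) = p * (p * ((23 + 12 * (p : ℚ_[p]) + 9 * (p : ℚ_[p]) ^ 2) *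
        108⁻¹)) * ((2 * p).choose p : ℚ_[p]) by ring, ← ht, mul_sum, ← sum_sub_distrib]
    refine sum_congr rfl fun k _ => ?_
    rw [natCast_choose_add_two]
    ring
  have hs : 2 * ∑ k ∈ range p, (-1) ^ k * ((k + 2).choose k : ℚ_[p]) * (franel k : ℚ_[p]) =
      ∑ k ∈ range p, (-1) ^ k * (k : ℚ_[p]) ^ 2 * (franel k : ℚ_[p]) +
        3 * ∑ k ∈ range p, (-1) ^ k * (k : ℚ_[p]) * (franel k : ℚ_[p]) +
        2 * ∑ k ∈ range p, (-1) ^ k * (franel k : ℚ_[p]) := by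
    rw [mul_sum, mul_sum, mul_sum, ← sum_add_distrib, ← sum_add_distrib]
    refine sum_congr rfl fun k _ => ?_
    rw [natCast_choose_add_two]
    ring
  have h10 : PadicDvd p 0 (10 / 27 : ℚ_[p]) := by
    convert (PadicDvd.natCast 40).mul_right hinv using 1
    norm_num
  convert ((((PadicDvd.natCast 2).mul_left (h2.add hsq)).sub
    ((PadicDvd.natCast 3).mul_left h1)).sub ((PadicDvd.natCast 2).mul_left h0)).add
      (h10.mul_left hb) using 1
  push_cast
  linear_combination -hs

theorem padicDvd_sum_choose_two_mul_mul_franel (hp : 3 < p) :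
    PadicDvd p 2 (∑ k ∈ range p, ((2 * k).choose k : ℚ_[p]) * (franel k : ℚ_[p]) / (-4) ^ k -
      ∑ k ∈ range p, ((2 * k).choose k : ℚ_[p]) ^ 3 / 16 ^ k) := by
  obtain ⟨r, hr⟩ : ∃ r : ℤ_[p], 2 * (r : ℚ_[p]) = -1 := by
    obtain ⟨z, hz⟩ := (PadicDvd.natCast_inv_of_lt (p := p) (k := 2) (by omega) (by omega)).neg
    refine ⟨z, ?_⟩
    rw [pow_zero, one_mul] at hz
    rw [← hz]
    norm_num
  have h := padicDvd_sum_ringChoose_mul_franel r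
  rw [PadicInt.coe_sum, PadicInt.coe_sum] at h
  convert h using 2
  · refine sum_congr rfl fun k _ => ?_
    rw [PadicInt.coe_mul, PadicInt.coe_mul, coe_ringChoose_add_neg_half hr, PadicInt.coe_natCast,
      PadicInt.coe_pow, PadicInt.coe_neg, PadicInt.coe_one, neg_pow (4 : ℚ_[p])]
    have : ((-1 : ℚ_[p]) ^ k) * (-1) ^ k = 1 := by rw [← mul_pow]; simp
    have h1 : (-1 : ℚ_[p]) ^ k ≠ 0 := by simp
    have h4 : (4 : ℚ_[p]) ^ k ≠ 0 := by simp
    field_simp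
    linear_combination (-((2 * k).choose k : ℚ_[p]) * (franel k : ℚ_[p])) * this
  · refine sum_congr rfl fun k _ => ?_
    rw [PadicInt.coe_mul, PadicInt.coe_pow, coe_ringChoose_add_neg_half hr, PadicInt.coe_natCast,
      div_pow, ← pow_mul, mul_comm k 2, pow_mul, show (4 : ℚ_[p]) ^ 2 = 16 by norm_num]
    ring

end FranelCongruences

/-! ### Product formulas and the row p-1 of Pascal's triangle -/

section PrimeBinomials

theorem prime_dvd_choose_pred_sub {p : ℕ} (hp : p.Prime) {k : ℕ} (hk : k < p) :
    (p : ℤ) ∣ ((p - 1).choose k : ℤ) - (-1) ^ k := by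
  induction k with
  | zero => simp
  | succ k ih =>
    have h := Nat.choose_succ_succ' (p - 1) k
    rw [Nat.sub_add_cancel hp.one_le] at h
    obtain ⟨a, ha⟩ : (p : ℤ) ∣ (p.choose (k + 1) : ℤ) :=
      Int.natCast_dvd_natCast.2 (hp.dvd_choose_self k.succ_ne_zero hk)
    obtain ⟨b, hb⟩ := ih (by omega)
    refine ⟨a - b, ?_⟩
    rw [h] at ha
    push_cast at ha
    rw [pow_succ]
    linear_combination ha - hb

theorem natCast_choose_eq_prod {K : Type*} [Field K] [CharZero K] (N k : ℕ) :
    (N.choose k : K) = (-1) ^ k * ∏ j ∈ range k, (1 - ((N : K) + 1) / ((j : K) + 1)) := by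
  induction k with
  | zero => simp
  | succ k ih =>
    have hk : (k : K) + 1 ≠ 0 := by exact_mod_cast k.succ_ne_zero
    have h := congrArg (Nat.cast : ℕ → K) (Nat.choose_succ_right_eq N k)
    rw [prod_range_succ, pow_succ]
    refine mul_right_cancel₀ hk ?_
    have h2 : ((N.choose k * (N - k) : ℕ) : K) = (N.choose k : K) * ((N : K) - k) := by
      rcases le_or_gt k N with hkN | hkN
      · rw [Nat.cast_mul, Nat.cast_sub hkN]
      · simp [Nat.choose_eq_zero_of_lt hkN]
    rw [h2, ih] at h
    push_cast at h
    rw [h]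
    field_simp
    ring

/-- Write C(2n,n) as 4^n times the odd numbers over the even numbers, and reverse the odd factors:
each becomes (2n+1) - 2(j+1). -/
theorem natCast_choose_two_mul_eq_prod {K : Type*} [Field K] [CharZero K] (n : ℕ) :
    ((2 * n).choose n : K) =
      (-1) ^ n * 4 ^ n * ∏ j ∈ range n, (1 - (2 * (n : K) + 1) / (2 * ((j : K) + 1))) := by
  have hj : ∀ j : ℕ, (2 : K) * ((j : K) + 1) ≠ 0 := fun j => by
    exact_mod_cast (by omega : 2 * (j + 1) ≠ 0)
  have h1 : ∀ m : ℕ, ((2 * m).choose m : K) * ∏ j ∈ range m, (2 * ((j : K) + 1)) =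
      4 ^ m * ∏ j ∈ range m, (2 * (j : K) + 1) := by
    intro m
    induction m with
    | zero => simp
    | succ m ih =>
      have h := congrArg (Nat.cast : ℕ → K) (Nat.succ_mul_centralBinom_succ m)
      simp only [Nat.centralBinom] at h
      rw [prod_range_succ, prod_range_succ, pow_succ]
      push_cast at h ⊢
      linear_combination 2 * (∏ j ∈ range m, (2 * ((j : K) + 1))) * h +
        4 * (2 * (m : K) + 1) * ih
  have h2 : ∏ j ∈ range n, (1 - (2 * (n : K) + 1) / (2 * ((j : K) + 1))) =
      ((-1) ^ n * ∏ j ∈ range n, (2 * (j : K) + 1)) / ∏ j ∈ range n, (2 * ((j : K) + 1)) := by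
    rw [← prod_range_reflect (fun j : ℕ => 2 * (j : K) + 1),
      show (-1 : K) ^ n = ∏ _j ∈ range n, (-1 : K) by simp, ← prod_mul_distrib, ← prod_div_distrib]
    refine prod_congr rfl fun j hjn => ?_
    have hjn : j < n := by simpa using hjn
    have := hj j
    rw [eq_div_iff this, Nat.cast_sub (by omega), Nat.cast_sub (by omega), sub_mul,
      div_mul_cancel₀ _ this]
    push_cast
    ring
  have h3 : ∏ j ∈ range n, (2 * ((j : K) + 1)) ≠ 0 := prod_ne_zero_iff.2 fun j _ => hj j
  have h4 : ((-1 : K) ^ n) * (-1) ^ n = 1 := by rw [← mul_pow]; simp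
  rw [h2, ← mul_div_assoc, eq_div_iff h3, h1]
  linear_combination (-4 ^ n * ∏ j ∈ range n, (2 * (j : K) + 1)) * h4

theorem prime_dvd_sum_pow {p : ℕ} [Fact p.Prime] {i : ℕ} (hi : i < p - 1) :
    (p : ℤ) ∣ ∑ k ∈ range p, (k : ℤ) ^ i := by
  rw [← ZMod.intCast_zmod_eq_zero_iff_dvd]
  have h := FiniteField.sum_pow_lt_card_sub_one (ZMod p) i (by rwa [ZMod.card])
  push_cast
  rw [← h]
  refine sum_bij (fun k _ => (k : ZMod p)) (fun _ _ => mem_univ _) ?_ ?_ (fun _ _ => rfl)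
  · intro a ha b hb hab
    rw [mem_range] at ha hb
    have := (ZMod.natCast_eq_natCast_iff' a b p).1 hab
    rwa [Nat.mod_eq_of_lt ha, Nat.mod_eq_of_lt hb] at this
  · intro b _
    exact ⟨b.val, mem_range.2 b.val_lt, ZMod.natCast_zmod_val b⟩

/-- Since C(p-1,k) ≡ (-1)^k mod p, the sum of (C(p-1,k) - (-1)^k)³ vanishes mod p³; expanding the
cube expresses f_{p-1} through three known sums. -/
theorem prime_cube_dvd_franel_pred_sub {p n : ℕ} (hp : p.Prime) (hn : p = 2 * n + 1) :
    (p : ℤ) ^ 3 ∣ (franel (p - 1) : ℤ) -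
      (1 - 3 * 2 ^ (p - 1) + 3 * ((-1) ^ n * ((2 * n).choose n : ℤ))) := by
  have h1 : ∑ k ∈ range (2 * n + 1), (-1 : ℤ) ^ k = 1 := by
    rw [neg_one_geom_sum, if_neg]
    simp
  have h2 : ∑ k ∈ range (2 * n + 1), ((2 * n).choose k : ℤ) = 2 ^ (2 * n) := by
    exact_mod_cast Nat.sum_range_choose (2 * n)
  have h3 := sum_neg_one_pow_mul_choose_sq n
  have hsub : p - 1 = 2 * n := by omega
  have h4 : (franel (p - 1) : ℤ) -
      (1 - 3 * 2 ^ (p - 1) + 3 * ((-1) ^ n * ((2 * n).choose n : ℤ))) =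
      ∑ k ∈ range (2 * n + 1), (-1) ^ k * ((-1) ^ k * (((2 * n).choose k : ℤ) - (-1) ^ k)) ^ 3 := by
    have h5 : (1 : ℤ) - 3 * 2 ^ (2 * n) + 3 * ((-1) ^ n * ((2 * n).choose n : ℤ)) =
        ∑ k ∈ range (2 * n + 1), (-1 : ℤ) ^ k -
          3 * ∑ k ∈ range (2 * n + 1), ((2 * n).choose k : ℤ) +
          3 * ∑ k ∈ range (2 * n + 1), (-1 : ℤ) ^ k * ((2 * n).choose k : ℤ) ^ 2 := by
      rw [h1, h2, h3]
    rw [hsub, h5, franel]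
    push_cast
    rw [mul_sum, mul_sum, ← sum_sub_distrib, ← sum_add_distrib, ← sum_sub_distrib]
    refine sum_congr rfl fun k _ => ?_
    rcases neg_one_pow_eq_or ℤ k with h | h <;> rw [h] <;> ring
  rw [h4]
  refine dvd_sum fun k hk => Dvd.dvd.mul_left (pow_dvd_pow_of_dvd (Dvd.dvd.mul_left ?_ _) 3) _
  rw [← hsub]
  exact prime_dvd_choose_pred_sub hp (by rw [mem_range] at hk; omega)

end PrimeBinomials

/-! ### Harmonic sums, Morley's congruence, and f_p and f_{p-1} mod p³ -/

section FranelCongruences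

variable {p : ℕ} [Fact p.Prime]

theorem Padic.natCast_prime_ne_zero : (p : ℚ_[p]) ≠ 0 :=
  Nat.cast_ne_zero.2 (Fact.out : p.Prime).ne_zero

/-- By Fermat 1/k² ≡ k^(p-3), and the power sum of exponent 0 < p-3 < p-1 vanishes mod p. -/
theorem padicDvd_sum_inv_sq (hp : 3 < p) :
    PadicDvd p 1 (∑ k ∈ Ico 1 p, ((k : ℚ_[p]) ^ 2)⁻¹) := by
  have hprime : p.Prime := Fact.out
  have h1 : PadicDvd p 1 (∑ k ∈ Ico 1 p, (k : ℚ_[p]) ^ (p - 3)) := by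
    have hz : (p : ℤ) ^ 1 ∣ ∑ k ∈ range p, (k : ℤ) ^ (p - 3) := by
      rw [pow_one]
      exact prime_dvd_sum_pow (by omega)
    have h := PadicDvd.of_int_dvd hz
    rw [range_eq_Ico, sum_eq_sum_Ico_succ_bot hprime.pos] at h
    push_cast at h
    rwa [zero_pow (by omega), zero_add] at h
  have h2 : PadicDvd p 1 (∑ k ∈ Ico 1 p, ((k : ℚ_[p]) ^ (p - 3) - ((k : ℚ_[p]) ^ 2)⁻¹)) := by
    refine PadicDvd.sum fun k hk => ?_
    rw [mem_Ico] at hk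
    have hk0 : (k : ℚ_[p]) ≠ 0 := Nat.cast_ne_zero.2 (by omega)
    have hf : PadicDvd p 1 ((k : ℚ_[p]) ^ (p - 1) - 1) := by
      have hco : IsCoprime (k : ℤ) p := by
        rw [Nat.isCoprime_iff_coprime]
        exact ((Nat.Prime.coprime_iff_not_dvd hprime).2
          (Nat.not_dvd_of_pos_of_lt (by omega) hk.2)).symm
      have hz : (p : ℤ) ^ 1 ∣ (k : ℤ) ^ (p - 1) - 1 := by
        rw [pow_one]
        exact (Int.ModEq.pow_card_sub_one_eq_one hprime hco).symm.dvd
      have := PadicDvd.of_int_dvd hz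
      push_cast at this
      exact this
    convert hf.mul_right ((PadicDvd.natCast_inv_of_lt (p := p) (by omega) hk.2).pow 2) using 1
    rw [show p - 1 = p - 3 + 2 by omega, pow_add]
    field_simp
  convert h1.sub h2 using 1
  rw [sum_sub_distrib]
  ring

theorem PadicDvd.inv_sq_reflect {k : ℕ} (h0 : 0 < k) (hk : k < p) :
    PadicDvd p 1 ((((p - k : ℕ) : ℚ_[p]) ^ 2)⁻¹ - ((k : ℚ_[p]) ^ 2)⁻¹) := by
  have h1 : (k : ℚ_[p]) ≠ 0 := Nat.cast_ne_zero.2 (by omega)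
  have h2 : ((p - k : ℕ) : ℚ_[p]) ≠ 0 := Nat.cast_ne_zero.2 (by omega)
  convert (PadicDvd.prime (p := p)).mul_right (((PadicDvd.intCast (2 * k - p)).mul_right
    ((PadicDvd.natCast_inv_of_lt h0 hk).pow 2)).mul_right
    ((PadicDvd.natCast_inv_of_lt (p := p) (k := p - k) (by omega) (by omega)).pow 2)) using 1
  field_simp
  rw [Nat.cast_sub hk.le]
  push_cast
  ring

theorem padicDvd_sum_inv_sq_half (hp : 3 < p) {n : ℕ} (hn : p = 2 * n + 1) :
    PadicDvd p 1 (∑ i ∈ range n, (((i : ℚ_[p]) + 1) ^ 2)⁻¹) := by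
  have h1 := padicDvd_sum_inv_sq hp
  have h2 : PadicDvd p 1 (∑ i ∈ range n, ((((p - (i + 1) : ℕ) : ℚ_[p]) ^ 2)⁻¹ -
      (((i + 1 : ℕ) : ℚ_[p]) ^ 2)⁻¹)) :=
    PadicDvd.sum fun i hi => by
      rw [mem_range] at hi
      exact PadicDvd.inv_sq_reflect (by omega) (by omega)
  have h3 : ∑ k ∈ Ico 1 p, ((k : ℚ_[p]) ^ 2)⁻¹ =
      ∑ i ∈ range n, (((i + 1 : ℕ) : ℚ_[p]) ^ 2)⁻¹ +
        ∑ i ∈ range n, (((p - (i + 1) : ℕ) : ℚ_[p]) ^ 2)⁻¹ := by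
    rw [← sum_Ico_consecutive _ (show 1 ≤ n + 1 by omega) (show n + 1 ≤ p by omega),
      sum_Ico_eq_sum_range, sum_Ico_eq_sum_range, Nat.add_sub_cancel,
      show p - (n + 1) = n by omega]
    congr 1
    · exact sum_congr rfl fun i _ => by rw [add_comm]
    · rw [← sum_range_reflect]
      refine sum_congr rfl fun i hi => ?_
      rw [mem_range] at hi
      rw [show n + 1 + (n - 1 - i) = p - (i + 1) by omega]
  have hhalf := PadicDvd.natCast_inv_of_lt (p := p) (k := 2) (by omega) (by omega)
  convert hhalf.mul_left (h1.sub h2) using 1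
  rw [h3, sum_sub_distrib]
  push_cast
  ring

theorem padicDvd_choose_sq_sub {k : ℕ} (h0 : 0 < k) (hk : k < p) :
    PadicDvd p 3 ((p.choose k : ℚ_[p]) ^ 2 - (p : ℚ_[p]) ^ 2 * ((k : ℚ_[p]) ^ 2)⁻¹) := by
  have hprime : p.Prime := Fact.out
  obtain ⟨m, rfl⟩ := Nat.exists_eq_add_of_le' h0
  have hm : ((m + 1 : ℕ) : ℚ_[p]) ≠ 0 := Nat.cast_ne_zero.2 m.succ_ne_zero
  have hinv := PadicDvd.natCast_inv_of_lt (p := p) h0 hk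
  have hc : (p.choose (m + 1) : ℚ_[p]) =
      p * (((p - 1).choose m : ℚ_[p]) * ((m + 1 : ℕ) : ℚ_[p])⁻¹) := by
    have h := congrArg (Nat.cast : ℕ → ℚ_[p]) (Nat.add_one_mul_choose_eq (p - 1) m)
    rw [Nat.sub_add_cancel hprime.one_le, Nat.cast_mul, Nat.cast_mul] at h
    rw [← mul_assoc, h, mul_inv_cancel_right₀ hm]
  have hz : (p : ℤ) ^ 1 ∣ ((p - 1).choose m : ℤ) - (-1) ^ m := by
    rw [pow_one]
    exact prime_dvd_choose_pred_sub hprime (by omega)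
  have h1 := PadicDvd.of_int_dvd hz
  push_cast at h1
  rw [hc]
  convert (PadicDvd.prime_pow (p := p) 2).mul ((h1.mul_right ((PadicDvd.natCast
    ((p - 1).choose m)).add (PadicDvd.neg_one_pow m))).mul_right (hinv.pow 2)) using 1
  have h4 : ((-1 : ℚ_[p]) ^ m) * (-1) ^ m = 1 := by rw [← mul_pow]; simp
  rw [inv_pow]
  linear_combination ((p : ℚ_[p]) ^ 2 * (((m + 1 : ℕ) : ℚ_[p]) ^ 2)⁻¹) * h4

/-- Both numbers are 2 mod p³: the inner cubes are divisible by p³, while the inner squares, which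
add to C(2p,p), are p²/k² mod p³ and sum to 0. -/
theorem padicDvd_franel_prime_sub (hp : 3 < p) :
    PadicDvd p 3 ((franel p : ℚ_[p]) - ((2 * p).choose p : ℚ_[p])) := by
  have hprime : p.Prime := Fact.out
  have hsum : ∀ e : ℕ, e ≠ 0 → ((∑ k ∈ range (p + 1), p.choose k ^ e : ℕ) : ℚ_[p]) =
      2 + ∑ k ∈ Ico 1 p, (p.choose k : ℚ_[p]) ^ e := by
    intro e he
    rw [range_eq_Ico, sum_Ico_succ_top (Nat.zero_le p), sum_eq_sum_Ico_succ_bot hprime.pos]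
    push_cast
    simp
    ring
  have h1 : PadicDvd p 3 (∑ k ∈ Ico 1 p, (p.choose k : ℚ_[p]) ^ 3) :=
    PadicDvd.sum fun k hk => by
      rw [mem_Ico] at hk
      rw [← Nat.cast_pow]
      exact PadicDvd.of_nat_dvd
        (pow_dvd_pow_of_dvd (hprime.dvd_choose_self (by omega) hk.2) 3)
  have h2 : PadicDvd p 3 (∑ k ∈ Ico 1 p, ((p.choose k : ℚ_[p]) ^ 2 -
      (p : ℚ_[p]) ^ 2 * ((k : ℚ_[p]) ^ 2)⁻¹)) :=
    PadicDvd.sum fun k hk => by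
      rw [mem_Ico] at hk
      exact padicDvd_choose_sq_sub (by omega) hk.2
  have h3 := (PadicDvd.prime_pow (p := p) 2).mul (padicDvd_sum_inv_sq hp)
  rw [← Nat.sum_range_choose_sq, franel, hsum 3 (by norm_num), hsum 2 (by norm_num)]
  convert h1.sub (h2.add h3) using 1
  rw [sum_sub_distrib, ← mul_sum]
  ring

/-- Let x = ∏(1-p/j), y = ∏(1-p/(2j)) over j ≤ n, and a = 2^(p-1). The signed central binomial
equals both x and a y. As (1-p/(2j))² = 1 - p/j + p²/(4j²), y² - x ≡ (p²/4) ∑ 1/j² ≡ 0 mod p³. So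
y(y-a) ≡ 0 with y a unit, whence y ≡ a and x ≡ a². -/
theorem padicDvd_morley (hp : 3 < p) {n : ℕ} (hn : p = 2 * n + 1) :
    PadicDvd p 3 ((-1) ^ n * ((2 * n).choose n : ℚ_[p]) - (2 ^ (p - 1)) ^ 2) := by
  set x : ℕ → ℚ_[p] := fun m => ∏ j ∈ range m, (1 - (p : ℚ_[p]) / ((j : ℚ_[p]) + 1)) with hx
  set y : ℕ → ℚ_[p] := fun m => ∏ j ∈ range m, (1 - (p : ℚ_[p]) / (2 * ((j : ℚ_[p]) + 1))) with hy
  set s : ℕ → ℚ_[p] := fun m => ∑ j ∈ range m, (((j : ℚ_[p]) + 1) ^ 2)⁻¹ with hs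
  have hsign : ((-1 : ℚ_[p]) ^ n) * (-1) ^ n = 1 := by rw [← mul_pow]; simp
  have hpn : (2 * (n : ℚ_[p]) + 1) = (p : ℚ_[p]) := by
    exact_mod_cast congrArg (Nat.cast : ℕ → ℚ_[p]) hn.symm
  have hxc : (-1) ^ n * ((2 * n).choose n : ℚ_[p]) = x n := by
    have := natCast_choose_eq_prod (K := ℚ_[p]) (2 * n) n
    push_cast at this
    rw [hpn] at this
    rw [this, ← mul_assoc, hsign, one_mul]
  have hyc : (-1) ^ n * ((2 * n).choose n : ℚ_[p]) = 2 ^ (p - 1) * y n := by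
    have := natCast_choose_two_mul_eq_prod (K := ℚ_[p]) n
    rw [hpn] at this
    rw [this, show p - 1 = 2 * n by omega, pow_mul, ← mul_assoc, ← mul_assoc, hsign, one_mul,
      show (2 : ℚ_[p]) ^ 2 = 4 by norm_num]
  have h2inv := PadicDvd.natCast_inv_of_lt (p := p) (k := 2) (by omega) (by omega)
  have hquad : ∀ m ≤ n, PadicDvd p 3 (y m ^ 2 - x m - (p : ℚ_[p]) ^ 2 * (2⁻¹ ^ 2 * s m)) ∧
      PadicDvd p 1 (x m - 1) ∧ PadicDvd p 1 (y m - 1) ∧ PadicDvd p 0 (s m) := by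
    intro m hm
    induction m with
    | zero => simp [hx, hy, hs, PadicDvd.zero]
    | succ m ih =>
      obtain ⟨i1, i2, i3, i4⟩ := ih (by omega)
      have hc := PadicDvd.natCast_inv_of_lt (p := p) (k := m + 1) (by omega) (by omega)
      have hc0 : (m : ℚ_[p]) + 1 ≠ 0 := by exact_mod_cast m.succ_ne_zero
      push_cast at hc h2inv
      have ex : x (m + 1) = x m * (1 - p * ((m : ℚ_[p]) + 1)⁻¹) := by
        rw [hx]
        simp only [prod_range_succ, div_eq_mul_inv]
      have ey : y (m + 1) = y m * (1 - p * (2⁻¹ * ((m : ℚ_[p]) + 1)⁻¹)) := by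
        rw [hy]
        simp only [prod_range_succ, div_eq_mul_inv, mul_inv]
      have es : s (m + 1) = s m + ((m : ℚ_[p]) + 1)⁻¹ ^ 2 := by
        rw [hs]
        simp only [sum_range_succ, inv_pow]
      rw [ex, ey, es]
      generalize ((m : ℚ_[p]) + 1)⁻¹ = c at *
      have hpc := (PadicDvd.prime (p := p)).mul_right hc
      have hpc2 := (PadicDvd.prime (p := p)).mul_right (h2inv.mul_left hc)
      have hx0 : PadicDvd p 0 (x m) := by
        simpa using (i2.mono (Nat.zero_le 1)).add PadicDvd.one
      have hy0 : PadicDvd p 0 (y m) := by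
        simpa using (i3.mono (Nat.zero_le 1)).add PadicDvd.one
      refine ⟨?_, ?_, ?_, i4.add (hc.pow 2)⟩
      · have hb : PadicDvd p 0 ((1 - p * (2⁻¹ * c)) ^ 2) :=
          (PadicDvd.one.sub (hpc2.mono (Nat.zero_le 1))).pow 2
        have hpp := PadicDvd.prime_pow (p := p) 2
        have hd : PadicDvd p 0 (2⁻¹ ^ 2 * s m) := (h2inv.pow 2).mul_left i4
        have he : PadicDvd p 0 (2⁻¹ ^ 2 * c ^ 2) := (h2inv.pow 2).mul_left (hc.pow 2)
        have hfac : PadicDvd p 1 (-(p * c) + p ^ 2 * (2⁻¹ ^ 2 * c ^ 2)) :=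
          hpc.neg.add ((hpp.mul_right he).mono one_le_two)
        convert ((i1.mul_right hb).add ((hpp.mul_right he).mul i2)).add
          ((hpp.mul_right hd).mul hfac) using 1
        ring
      · convert i2.sub (hx0.mul_left hpc) using 1
        ring
      · convert i3.sub (hy0.mul_left hpc2) using 1
        ring
  obtain ⟨h1, -, h3, -⟩ := hquad n le_rfl
  have hsq : PadicDvd p 3 (y n ^ 2 - x n) := by
    push_cast at h2inv
    convert h1.add ((PadicDvd.prime_pow (p := p) 2).mul
      ((h2inv.pow 2).mul_left (padicDvd_sum_inv_sq_half hp hn))) using 1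
    ring
  set a : ℚ_[p] := 2 ^ (p - 1) with ha
  have hxy : x n = a * y n := hxc.symm.trans hyc
  have ha0 : PadicDvd p 0 a := (PadicDvd.natCast (p := p) 2).pow (p - 1)
  have hy0 : PadicDvd p 0 (y n) := by
    simpa using (h3.mono (Nat.zero_le 1)).add PadicDvd.one
  have hprod : PadicDvd p 3 (y n * (y n - a)) := by
    convert hsq using 1
    rw [hxy]
    ring
  -- Cancels the unit y without inverting it: y - a = y(y-a) - (y-1)(y-a), and p ∣ y-1 gains one
  -- power of p at each step.
  have hstep : ∀ i ≤ 3, PadicDvd p i (y n - a) := by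
    intro i hi
    induction i with
    | zero => exact hy0.sub ha0
    | succ i ih =>
      have h5 := h3.mul (ih (by omega))
      rw [add_comm 1 i] at h5
      convert (hprod.mono hi).sub h5 using 1
      ring
  rw [hxc, hxy]
  convert ha0.mul_left (hstep 3 le_rfl) using 1
  ring

theorem padicDvd_franel_pred_sub (hp : 3 < p) :
    PadicDvd p 3 ((franel (p - 1) : ℚ_[p]) -
      (1 - 3 * 2 ^ (p - 1) + 3 * (2 ^ (p - 1)) ^ 2)) := by
  have hprime : p.Prime := Fact.out
  obtain ⟨n, hn⟩ := hprime.odd_of_ne_two (by omega)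
  have h1 := PadicDvd.of_int_dvd (prime_cube_dvd_franel_pred_sub hprime hn)
  have h2 := (PadicDvd.natCast (p := p) 3).mul_left (padicDvd_morley hp hn)
  push_cast at h1 h2
  convert h1.add h2 using 1
  ring

end FranelCongruences

/-! ### Weights with denominators l, l² and l+1 -/

section FranelCongruences

variable {p : ℕ} [Fact p.Prime]

theorem sum_choose_two_mul_mul_choose_add (n : ℕ) :
    ∑ k ∈ range n, (2 * k).choose k * n.choose k * k.choose (n - k) + (2 * n).choose n =
      franel n := by
  rw [franel_eq_sum, sum_range_succ]
  simp

theorem padicDvd_sum_mul_sum_choose {w : ℕ → ℚ_[p]} {a b : ℕ} (ha : p ≤ a)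
    (hw : ∀ l ∈ Ico a b, PadicDvd p 0 (w l)) :
    PadicDvd p 2 (∑ l ∈ Ico a b, w l *
      ((∑ k ∈ range p, (2 * k).choose k * l.choose k * k.choose (l - k) : ℕ) : ℚ_[p])) :=
  PadicDvd.sum fun l hl => (hw l hl).mul_left
    (PadicDvd.of_nat_dvd (sq_dvd_sum_choose Fact.out (ha.trans (mem_Ico.1 hl).1)))

theorem padicDvd_neg_one_pow_div {l : ℕ} (h1 : p < l) (h2 : l < 2 * p) (e : ℕ) :
    PadicDvd p 0 ((-1) ^ l / (l : ℚ_[p]) ^ e) := by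
  rw [div_eq_mul_inv, ← inv_pow]
  refine (PadicDvd.neg_one_pow l).mul_left ((PadicDvd.natCast_inv ?_).pow e)
  rintro ⟨c, rfl⟩
  have hc1 : 1 < c := by
    by_contra h
    have : c ≤ 1 := by omega
    nlinarith
  nlinarith

theorem padicDvd_sum_neg_one_pow_div_mul_franel (hp : 3 < p) {e : ℕ} (he : 0 < e) (he2 : e ≤ 2) :
    PadicDvd p (3 - e) (∑ k ∈ Ico 1 p, (-1) ^ k / (k : ℚ_[p]) ^ e * (franel k : ℚ_[p]) -
      ∑ k ∈ Ico 1 p, ((2 * k).choose k : ℚ_[p]) * ∑ j ∈ range (k + 1),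
        (-1) ^ (k + j) / ((k + j : ℕ) : ℚ_[p]) ^ e * ((k + j).choose k : ℚ_[p]) *
          (k.choose j : ℚ_[p])) := by
  have h := sum_mul_franel (fun l => (-1) ^ l / (l : ℚ_[p]) ^ e) p
  have hbot : ∀ f : ℕ → ℚ_[p], f 0 = 0 → ∑ k ∈ range p, f k = ∑ k ∈ Ico 1 p, f k := by
    intro f hf
    rw [range_eq_Ico, sum_eq_sum_Ico_succ_bot (by omega), hf, zero_add]
  rw [hbot _ (by simp [he.ne']), hbot _ (by simp [he.ne'])] at h
  rw [h, sub_sub_cancel_left]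
  refine PadicDvd.neg ?_
  -- Isolates l = p, the only tail index divisible by p. Its coefficient omits k = p from the
  -- expansion of f_p, hence equals f_p - C(2p,p).
  rw [sum_eq_sum_Ico_succ_bot (by omega)]
  refine PadicDvd.add ?_ (PadicDvd.mono (by omega) (padicDvd_sum_mul_sum_choose (by omega)
    fun l hl => ?_))
  · have h1 := congrArg (Nat.cast : ℕ → ℚ_[p]) (sum_choose_two_mul_mul_choose_add p)
    rw [Nat.cast_add, ← eq_sub_iff_add_eq] at h1
    rw [h1]
    have h2 : PadicDvd p (3 - e + e)
        ((-1) ^ p * ((franel p : ℚ_[p]) - ((2 * p).choose p : ℚ_[p]))) := by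
      rw [Nat.sub_add_cancel (by omega)]
      exact (PadicDvd.neg_one_pow p).mul_left (padicDvd_franel_prime_sub hp)
    convert h2.div_prime_pow using 1
    ring
  · rw [mem_Ico] at hl
    exact padicDvd_neg_one_pow_div (by omega) (by omega) e

theorem padicDvd_sum_neg_one_pow_div_self_mul_franel (hp : 3 < p) :
    PadicDvd p 2 (∑ k ∈ Ico 1 p, (-1) ^ k / (k : ℚ_[p]) * (franel k : ℚ_[p])) := by
  have h := padicDvd_sum_neg_one_pow_div_mul_franel hp one_pos one_le_two
  simp only [pow_one] at h
  rw [sum_eq_zero (s := Ico 1 p) (f := fun k => ((2 * k).choose k : ℚ_[p]) *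
    ∑ j ∈ range (k + 1), (-1) ^ (k + j) / ((k + j : ℕ) : ℚ_[p]) * ((k + j).choose k : ℚ_[p]) *
      (k.choose j : ℚ_[p])) fun k hk => by
    rw [sum_neg_one_pow_div_mul_choose (mem_Ico.1 hk).1, mul_zero], sub_zero] at h
  exact h

theorem padicDvd_sum_neg_one_pow_div_sq_mul_franel (hp : 3 < p) :
    PadicDvd p 1 (∑ k ∈ Ico 1 p, (-1) ^ k / (k : ℚ_[p]) ^ 2 * (franel k : ℚ_[p])) := by
  have h := padicDvd_sum_neg_one_pow_div_mul_franel hp two_pos le_rfl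
  rw [sum_congr rfl fun k hk =>
    choose_mul_sum_neg_one_pow_div_sq_mul_choose (K := ℚ_[p]) (mem_Ico.1 hk).1] at h
  change PadicDvd p 1 _ at h
  convert h.sub (padicDvd_sum_inv_sq hp) using 1
  rw [sum_neg_distrib]
  ring

/-- The index k = (p-1)/2 contributes 1/p. The others pair up as 1/(p-2i) + 1/(p+2i) ≡ -p/(2i²) mod
p², and ∑ 1/i² over i ≤ (p-1)/2 is 0 mod p. -/
theorem padicDvd_sum_inv_odd_sub (hp : 3 < p) :
    PadicDvd p 2 (∑ k ∈ range p, (2 * (k : ℚ_[p]) + 1)⁻¹ - (p : ℚ_[p])⁻¹) := by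
  have hprime : p.Prime := Fact.out
  obtain ⟨n, hn⟩ := hprime.odd_of_ne_two (by omega)
  have hpn : (2 * (n : ℚ_[p]) + 1) = (p : ℚ_[p]) := by
    exact_mod_cast congrArg (Nat.cast : ℕ → ℚ_[p]) hn.symm
  have hsplit : ∑ k ∈ range p, (2 * (k : ℚ_[p]) + 1)⁻¹ = (p : ℚ_[p])⁻¹ +
      ∑ i ∈ range n, (((p : ℚ_[p]) - 2 * (i + 1))⁻¹ + ((p : ℚ_[p]) + 2 * (i + 1))⁻¹) := by
    have h0 : ∑ k ∈ range p, (2 * (k : ℚ_[p]) + 1)⁻¹ =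
        ∑ k ∈ range (n + 1 + n), (2 * (k : ℚ_[p]) + 1)⁻¹ :=
      congrArg (fun m => ∑ k ∈ range m, (2 * (k : ℚ_[p]) + 1)⁻¹) (by omega)
    rw [h0, sum_range_add, sum_range_succ, hpn, sum_add_distrib,
      ← sum_range_reflect (fun k : ℕ => (2 * (k : ℚ_[p]) + 1)⁻¹) n]
    have h1 : ∀ i ∈ range n, (2 * ((n - 1 - i : ℕ) : ℚ_[p]) + 1)⁻¹ =
        ((p : ℚ_[p]) - 2 * (i + 1))⁻¹ := by
      intro i hi
      rw [mem_range] at hi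
      rw [Nat.cast_sub (by omega), Nat.cast_sub (by omega), ← hpn]
      push_cast
      ring
    have h2 : ∀ i ∈ range n, (2 * ((n + 1 + i : ℕ) : ℚ_[p]) + 1)⁻¹ =
        ((p : ℚ_[p]) + 2 * (i + 1))⁻¹ := by
      intro i _
      rw [← hpn]
      push_cast
      ring
    rw [sum_congr rfl h1, sum_congr rfl h2]
    ring
  have hhalf := PadicDvd.natCast_inv_of_lt (p := p) (k := 2) (by omega) (by omega)
  push_cast at hhalf
  have hterm : PadicDvd p 2 (∑ i ∈ range n, (((p : ℚ_[p]) - 2 * (i + 1))⁻¹ +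
      ((p : ℚ_[p]) + 2 * (i + 1))⁻¹ + p * 2⁻¹ * (((i : ℚ_[p]) + 1) ^ 2)⁻¹)) := by
    refine PadicDvd.sum fun i hi => ?_
    rw [mem_range] at hi
    have e1 : ((p : ℚ_[p]) - 2 * (i + 1)) = ((p - 2 * (i + 1) : ℕ) : ℚ_[p]) := by
      rw [Nat.cast_sub (by omega)]
      push_cast
      ring
    have e2 : ((p : ℚ_[p]) + 2 * (i + 1)) = ((p + 2 * (i + 1) : ℕ) : ℚ_[p]) := by
      push_cast
      ring
    have d1 : PadicDvd p 0 ((p : ℚ_[p]) - 2 * (i + 1))⁻¹ := by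
      rw [e1]
      exact PadicDvd.natCast_inv_of_lt (by omega) (by omega)
    have d2 : PadicDvd p 0 ((p : ℚ_[p]) + 2 * (i + 1))⁻¹ := by
      rw [e2]
      refine PadicDvd.natCast_inv fun h => ?_
      exact Nat.not_dvd_of_pos_of_lt (by omega) (by omega) ((Nat.dvd_add_right (dvd_refl p)).1 h)
    have d3 : PadicDvd p 0 ((i : ℚ_[p]) + 1)⁻¹ := by
      exact_mod_cast PadicDvd.natCast_inv_of_lt (p := p) (k := i + 1) (by omega) (by omega)
    have z1 : (p : ℚ_[p]) - 2 * (i + 1) ≠ 0 := by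
      rw [e1]
      exact Nat.cast_ne_zero.2 (by omega)
    have z2 : (p : ℚ_[p]) + 2 * (i + 1) ≠ 0 := by
      rw [e2]
      exact Nat.cast_ne_zero.2 (by omega)
    have z3 : (i : ℚ_[p]) + 1 ≠ 0 := by exact_mod_cast i.succ_ne_zero
    convert (PadicDvd.prime_pow (p := p) 2).mul_right
      (((((PadicDvd.prime (p := p)).mono (Nat.zero_le 1)).mul_left hhalf).mul_left
        (d3.pow 2)).mul_left (d1.mul_left d2)) using 1
    field_simp
    ring
  convert hterm.sub ((PadicDvd.prime (p := p)).mul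
    (hhalf.mul_left (padicDvd_sum_inv_sq_half hp hn))) using 1
  rw [hsplit, sum_add_distrib (g := fun i : ℕ => (p : ℚ_[p]) * 2⁻¹ * (((i : ℚ_[p]) + 1) ^ 2)⁻¹),
    ← mul_sum]
  ring

theorem padicDvd_sum_neg_one_pow_div_succ_mul_franel (hp : 3 < p) :
    PadicDvd p 2 (∑ l ∈ range p, (-1) ^ l / ((l : ℚ_[p]) + 1) * (franel l : ℚ_[p]) -
      (p : ℚ_[p])⁻¹) := by
  have h := sum_mul_franel (fun l => (-1) ^ l / ((l : ℚ_[p]) + 1)) p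
  simp only [choose_mul_sum_neg_one_pow_div_succ_mul_choose] at h
  have herr : PadicDvd p 2 (∑ l ∈ Ico p (2 * p - 1), (-1) ^ l / ((l : ℚ_[p]) + 1) *
      ((∑ k ∈ range p, (2 * k).choose k * l.choose k * k.choose (l - k) : ℕ) : ℚ_[p])) := by
    refine padicDvd_sum_mul_sum_choose (w := fun l => (-1) ^ l / ((l : ℚ_[p]) + 1)) le_rfl
      fun l hl => ?_
    rw [mem_Ico] at hl
    convert (padicDvd_neg_one_pow_div (p := p) (l := l + 1) (by omega) (by omega) 1).neg using 1
    push_cast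
    ring
  rw [h]
  convert (padicDvd_sum_inv_odd_sub hp).sub herr using 1
  ring

theorem padicDvd_sum_neg_one_pow_div_mul_franel_pred (hp : 3 < p) :
    PadicDvd p 2 (∑ k ∈ Ico 1 p, (-1) ^ k / (k : ℚ_[p]) * (franel (k - 1) : ℚ_[p]) -
      (3 * (fermatQuotient p 2 : ℚ_[p]) +
        3 * (p : ℚ_[p]) * (fermatQuotient p 2 : ℚ_[p]) ^ 2)) := by
  have hprime : p.Prime := Fact.out
  have hp0 := Padic.natCast_prime_ne_zero (p := p)
  have hT := padicDvd_sum_neg_one_pow_div_succ_mul_franel hp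
  have hF := padicDvd_franel_pred_sub hp
  have hF' := PadicDvd.div_prime_pow (n := 2) (m := 1) hF
  obtain ⟨m, hm⟩ : ∃ m, p = m + 1 := ⟨p - 1, by omega⟩
  have hpm : p - 1 = m := by omega
  have heven : Even m := by
    have := hprime.odd_of_ne_two (by omega)
    rw [hm] at this
    exact (Nat.even_add_one.not_left.1 (Nat.not_even_iff_odd.2 this))
  have hmp : (m : ℚ_[p]) + 1 = p := by
    exact_mod_cast congrArg (Nat.cast : ℕ → ℚ_[p]) hm.symm
  have hq : (fermatQuotient p 2 : ℚ_[p]) = (2 ^ m - 1) / p := by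
    rw [fermatQuotient, hpm]
    push_cast
    rfl
  have hS : ∑ k ∈ Ico 1 p, (-1) ^ k / (k : ℚ_[p]) * (franel (k - 1) : ℚ_[p]) =
      -∑ l ∈ range m, (-1) ^ l / ((l : ℚ_[p]) + 1) * (franel l : ℚ_[p]) := by
    rw [sum_Ico_eq_sum_range, hpm, ← sum_neg_distrib]
    refine sum_congr rfl fun l _ => ?_
    rw [Nat.add_sub_cancel_left, add_comm 1 l, pow_succ]
    push_cast
    ring
  have hsum : ∑ l ∈ range p, (-1) ^ l / ((l : ℚ_[p]) + 1) * (franel l : ℚ_[p]) =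
      ∑ l ∈ range m, (-1) ^ l / ((l : ℚ_[p]) + 1) * (franel l : ℚ_[p]) +
        (franel m : ℚ_[p]) / p := by
    have h0 : ∑ l ∈ range p, (-1) ^ l / ((l : ℚ_[p]) + 1) * (franel l : ℚ_[p]) =
        ∑ l ∈ range (m + 1), (-1) ^ l / ((l : ℚ_[p]) + 1) * (franel l : ℚ_[p]) :=
      congrArg (fun N => ∑ l ∈ range N, (-1) ^ l / ((l : ℚ_[p]) + 1) * (franel l : ℚ_[p])) hm
    rw [h0, sum_range_succ, heven.neg_one_pow, hmp]
    ring
  rw [hsum] at hT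
  rw [hpm, pow_one] at hF'
  rw [hS, hq]
  -- The sum is (f_{p-1} - 1)/p mod p². With a = 2^(p-1) = 1 + p q, f_{p-1} - 1 ≡ 3a(a-1) =
  -- 3pq(1+pq) mod p³.
  convert hF'.sub hT using 1
  field_simp
  ring

end FranelCongruences

end

theorem theorem1p1 (p : ℕ) [Fact p.Prime] (hp : 3 < p) :
    (∀ r : ℤ_[p],
      PadicCongr p 2
        ((∑ k ∈ Finset.range p,
          (-1) ^ k * Ring.choose ((k : ℤ_[p]) + r) k * (franel k : ℤ_[p]) : ℤ_[p]) : ℚ_[p])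
        ((∑ k ∈ Finset.range p,
          ((2 * k).choose k : ℤ_[p]) * Ring.choose ((k : ℤ_[p]) + r) k ^ 2 : ℤ_[p]) : ℚ_[p])) ∧
    PadicCongr p 2
      (∑ k ∈ Finset.range p, (-1) ^ k * (franel k : ℚ_[p]))
      (legendreSym 3 (p : ℤ) : ℚ_[p]) ∧
    PadicCongr p 2
      (∑ k ∈ Finset.range p, (-1) ^ k * (k : ℚ_[p]) * (franel k : ℚ_[p]))
      (-(2 / 3) * (legendreSym 3 (p : ℤ) : ℚ_[p])) ∧
    PadicCongr p 2
      (∑ k ∈ Finset.range p, (-1) ^ k * (k : ℚ_[p]) ^ 2 * (franel k : ℚ_[p]))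
      (10 / 27 * (legendreSym 3 (p : ℤ) : ℚ_[p])) ∧
    PadicCongr p 2
      (∑ k ∈ Finset.range p, ((2 * k).choose k : ℚ_[p]) * (franel k : ℚ_[p]) / (-4) ^ k)
      (∑ k ∈ Finset.range p, ((2 * k).choose k : ℚ_[p]) ^ 3 / 16 ^ k) ∧
    PadicCongr p 2
      (∑ k ∈ Finset.Icc 1 (p - 1), (-1) ^ k / (k : ℚ_[p]) * (franel k : ℚ_[p])) 0 ∧
    PadicCongr p 1
      (∑ k ∈ Finset.Icc 1 (p - 1), (-1) ^ k / (k : ℚ_[p]) ^ 2 * (franel k : ℚ_[p])) 0 ∧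
    PadicCongr p 2
      (∑ k ∈ Finset.Icc 1 (p - 1), (-1) ^ k / (k : ℚ_[p]) * (franel (k - 1) : ℚ_[p]))
      (3 * (fermatQuotient p 2 : ℚ_[p]) + 3 * (p : ℚ_[p]) * (fermatQuotient p 2 : ℚ_[p]) ^ 2) := by
  have hIcc : Finset.Icc 1 (p - 1) = Finset.Ico 1 p := by
    ext k
    simp only [Finset.mem_Icc, Finset.mem_Ico]
    omega
  have hleg : (legendreSym 3 (p : ℤ) : ℚ_[p]) = (legendreThree p : ℚ_[p]) := by
    rw [legendreSym_three_natCast]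
  rw [hIcc, hleg]
  refine ⟨padicDvd_sum_ringChoose_mul_franel, padicDvd_sum_neg_one_pow_mul_franel (by omega),
    padicDvd_sum_neg_one_pow_mul_self_mul_franel hp, padicDvd_sum_neg_one_pow_mul_sq_mul_franel hp,
    padicDvd_sum_choose_two_mul_mul_franel hp, ?_, ?_,
    padicDvd_sum_neg_one_pow_div_mul_franel_pred hp⟩
  · obtain ⟨z, hz⟩ := padicDvd_sum_neg_one_pow_div_self_mul_franel hp
    exact ⟨z, by rw [sub_zero, hz]⟩
  · obtain ⟨z, hz⟩ := padicDvd_sum_neg_one_pow_div_sq_mul_franel hp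
    exact ⟨z, by rw [sub_zero, hz]⟩
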